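/- Let $d\in\mathbb N$; for $\mathbf k\in\mathbb Z^d$ put $|\mathbf k|=\max_v|k_v|$ and $\langle\mathbf k\rangle=\max\{1,|\mathbf k|\}$. Let $\mathfrak B$ be a translation invariant Banach algebra of complex sequences on $\mathbb Z^d$: a unital algebra of sequences under pointwise operations, complete for a submultiplicative norm with $\|1\|_{\mathfrak B}=1$, and such that all translations $(\sigma_{\mathbf j}a)_{\mathbf i}=a_{\mathbf i-\mathbf j}$ map $\mathfrak B$ to itself isometrically. A complex sequence $p$ belongs to $DC_{\mathfrak B}(\tau,\gamma)$ (is $(\tau,\gamma)$-distal) if for every $\mathbf k\ne\mathbf 0$ the sequence $p-\sigma_{\mathbf k}p$ has no zero, its pointwise inverse lies in $\mathfrak B$, and $\|(p-\sigma_{\mathbf k}p)^{-1}\|_{\mathfrak B}\le\gamma^{-1}|\mathbf k|^{\tau}$. For a matrix $A=(a_{\mathbf i,\mathbf j})_{\mathbf i,\mathbf j\in\mathbb Z^d}$ whose diagonals $A_{\mathbf k}=(a_{\mathbf i,\mathbf i-\mathbf k})_{\mathbf i}$ all lie in $\mathfrak B$, put $\|A\|_{s}^2=\sum_{\mathbf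 k}\|A_{\mathbf k}\|_{\mathfrak B}^2\langle\mathbf k\rangle^{2s}$; let $\mathcal M_0^\infty$ be the set of such matrices that are diagonal and satisfy $\|A\|_s<\infty$ for all $s\ge0$. Fix $\alpha_0>d/2$, $\tau>0$, $\gamma>0$, $\delta>0$ and $s>\alpha_0+\tau+d/2+12\delta$. Then there are $C=C(s,d,\delta,\tau,\alpha_0)>0$ and $\epsilon_0=\epsilon_0(s,d,\delta,\tau,\gamma,\alpha_0)>0$ such that the following holds for every such $\mathfrak B$. Let $\phi\in\mathbb R^{\mathbb Z^d}$ satisfy $\phi_{\mathbf 0}=0$ and $|\phi_{\mathbf i}|\le|\mathbf i|^{-s}$ for $\mathbf i\neq\mathbf 0$, let $(T_\phi u)_{\mathbf i}=\sum_{\mathbf j}\phi_{\mathbf i-\mathbf j}u_{\mathbf j}$, let $D=\mathrm{diag}(d_{\mathbf i})$ with $(d_{\mathbf i})\in DC_{\mathfrak B}(\tau,\gamma)$, and suppose $\|T_\phi\|_{s-d/2-\delta}\le\epsilon_0$. Then there is $D'=\mathrm{diag}(d'_{\mathbf i})$ with $D'-D\in\mathcal M_0^\infty$ and $$\|D-D'\|_0\le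 C\|T_\phi\|_{s-d/2-\delta},$$ and also, if $s-d/2-5\delta-\alpha_0>\tfrac12$, $$\|D-D'\|_0\le C\|T_\phi\|_{s-d/2-\delta}^{\frac1{s-d/2-5\delta-\alpha_0}},$$ such that the operator $H'=T_\phi+D'$ on $\ell^2(\mathbb Z^d)$ (with domain $\{u\in\ell^2: D'u\in\ell^2\}$) has pure point spectrum, that is, its eigenvectors span a dense subspace; moreover it has a complete set of eigenfunctions $\{e_{\mathbf k}\}_{\mathbf k\in\mathbb Z^d}$ (eigenvectors in $\ell^2(\mathbb Z^d)$ with dense linear span) satisfying $$|(e_{\mathbf k})_{\mathbf i}|\le2\langle\mathbf i-\mathbf k\rangle^{-s+\tau+d/2+12\delta}\qquad(\mathbf i,\mathbf k\in\mathbb Z^d).$$ If $(d_{\mathbf i})$ is real-valued, then the spectrum of $H'$ is the closure of $\{d_{\mathbf i}:\mathbf i\in\mathbb Z^d\}$ in $\mathbb R$. -/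

import Mathlib

open scoped ENNReal Topology
open Filter

noncomputable section

namespace PowerLaw

/-- The lattice `ℤ^d`. Its norm `‖k‖` in Mathlib is the sup norm `|k| = max_v |k_v|`. -/
abbrev Lat (d : ℕ) : Type := Fin d → ℤ

/-- The bracket `⟨k⟩ = max {1, |k|}`. -/
def bracket {d : ℕ} (k : Lat d) : ℝ := max 1 ‖k‖

/-- The translation `(σ_j a)_i = a_{i-j}`. -/
def shift {d : ℕ} (j : Lat d) (a : Lat d → ℂ) : Lat d → ℂ := fun i => a (i - j)

/-- A translation invariant Banach algebra of complex sequences indexed by `ℤ^d`, with the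
pointwise operations: a unital subalgebra of all sequences, with a complete submultiplicative
norm for which the constant sequence `1` has norm `1` and all translations are isometric. -/
structure TransInvBanachAlgebra (d : ℕ) where
  /-- the sequences that belong to the algebra -/
  carrier : Subalgebra ℂ (Lat d → ℂ)
  /-- the norm (a submultiplicative algebra norm) -/
  nrm : AlgebraNorm ℂ carrier
  nrm_one : nrm 1 = 1
  complete : ∀ u : ℕ → carrier,
    (∀ ε : ℝ, 0 < ε → ∃ N : ℕ, ∀ m ≥ N, ∀ n ≥ N, nrm (u m - u n) < ε) →
      ∃ a : carrier, Tendsto (fun n => nrm (u n - a)) atTop (𝓝 0)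
  shift_mem : ∀ (j : Lat d) (a : Lat d → ℂ), a ∈ carrier → shift j a ∈ carrier
  nrm_shift : ∀ (j : Lat d) (a : carrier), nrm ⟨shift j a, shift_mem j a a.2⟩ = nrm a

variable {d : ℕ}

open Classical in
/-- The norm of the algebra, extended by `∞` to the sequences outside the algebra. -/
def TransInvBanachAlgebra.extNorm (B : TransInvBanachAlgebra d) (a : Lat d → ℂ) : ℝ≥0∞ :=
  if h : a ∈ B.carrier then ENNReal.ofReal (B.nrm ⟨a, h⟩) else ∞

/-- `DC_𝔅(τ, γ)`: the `(τ, γ)`-distal sequences for `𝔅`. For every `k ≠ 0` the sequence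
`p - σ_k p` has no zero, and its pointwise inverse belongs to `𝔅` and has norm at most
`γ⁻¹ |k|^τ`. -/
def TransInvBanachAlgebra.distal (B : TransInvBanachAlgebra d) (τ γ : ℝ) :
    Set (Lat d → ℂ) :=
  {p | ∀ k : Lat d, k ≠ 0 → (∀ i, p i - shift k p i ≠ 0) ∧
    ∃ h : (fun i => (p i - shift k p i)⁻¹) ∈ B.carrier,
      B.nrm ⟨fun i => (p i - shift k p i)⁻¹, h⟩ ≤ γ⁻¹ * ‖k‖ ^ τ}

/-- The `k`-diagonal `A_k = (a_{i,i-k})_i` of an infinite matrix. -/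
def kDiag (A : Matrix (Lat d) (Lat d) ℂ) (k : Lat d) : Lat d → ℂ := fun i => A i (i - k)

/-- The Sobolev norm `‖A‖_s = (∑_k ‖A_k‖_𝔅² ⟨k⟩^{2s})^{1/2}`; it is `∞` if the series diverges or
if some diagonal of `A` is not in `𝔅`. -/
def TransInvBanachAlgebra.sobNorm (B : TransInvBanachAlgebra d)
    (A : Matrix (Lat d) (Lat d) ℂ) (s : ℝ) : ℝ≥0∞ :=
  (∑' k : Lat d, B.extNorm (kDiag A k) ^ 2 * ENNReal.ofReal (bracket k ^ (2 * s))) ^ (1 / 2 : ℝ)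

/-- `𝓜^s`: the matrices with all diagonals in `𝔅` and with finite Sobolev norm. -/
def TransInvBanachAlgebra.sobSpace (B : TransInvBanachAlgebra d) (s : ℝ) :
    Set (Matrix (Lat d) (Lat d) ℂ) :=
  {A | (∀ k, kDiag A k ∈ B.carrier) ∧ B.sobNorm A s < ∞}

/-- `𝓜₀^∞`: the diagonal matrices that belong to `𝓜^s` for all `s ≥ 0`. -/
def TransInvBanachAlgebra.diagSpace (B : TransInvBanachAlgebra d) :
    Set (Matrix (Lat d) (Lat d) ℂ) :=
  {A | (∀ s : ℝ, 0 ≤ s → A ∈ B.sobSpace s) ∧ ∀ i j, i ≠ j → A i j = 0}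

/-- The matrix `(φ_{i-j})_{i,j}` of the hopping operator `T_φ`. -/
def hopping (φ : Lat d → ℝ) : Matrix (Lat d) (Lat d) ℂ := fun i j => (φ (i - j) : ℂ)

/-- The Hilbert space `ℓ²(ℤ^d)`. -/
abbrev ell2 (d : ℕ) : Type := lp (fun _ : Lat d => ℂ) 2

/-- The action `(A u)_i = ∑_j A_{i,j} u_j` of a matrix on a sequence. -/
def matAct (A : Matrix (Lat d) (Lat d) ℂ) (u : Lat d → ℂ) : Lat d → ℂ :=
  fun i => ∑' j, A i j * u j

/-- The maximal domain of a matrix in `ℓ²(ℤ^d)`: all series converge and the result is in `ℓ²`. -/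
def matDomain (A : Matrix (Lat d) (Lat d) ℂ) : Submodule ℂ (ell2 d) where
  carrier := {u | (∀ i, Summable fun j => A i j * u j) ∧ Memℓp (matAct A u) 2}
  zero_mem' := by
    refine ⟨fun i => by simp [summable_zero], ?_⟩
    have : matAct A ((0 : ell2 d) : Lat d → ℂ) = 0 := by
      funext i; simp [matAct]
    rw [this]; exact zero_memℓp
  add_mem' := by
    rintro u v ⟨hu, hu'⟩ ⟨hv, hv'⟩
    have hs : ∀ i, (fun j => A i j * (u + v) j) = fun j => A i j * u j + A i j * v j := by
      intro i; funext j; simp [mul_add]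
    refine ⟨fun i => by rw [hs i]; exact (hu i).add (hv i), ?_⟩
    have : matAct A ((u + v : ell2 d) : Lat d → ℂ) = matAct A u + matAct A v := by
      funext i
      simp only [matAct, Pi.add_apply]
      rw [hs i]; exact (hu i).tsum_add (hv i)
    rw [this]; exact hu'.add hv'
  smul_mem' := by
    rintro c u ⟨hu, hu'⟩
    have hs : ∀ i, (fun j => A i j * (c • u) j) = fun j => c * (A i j * u j) := by
      intro i; funext j; simp; ring
    refine ⟨fun i => by rw [hs i]; exact (hu i).mul_left c, ?_⟩
    have : matAct A ((c • u : ell2 d) : Lat d → ℂ) = c • matAct A u := by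
      funext i
      simp only [matAct, Pi.smul_apply, smul_eq_mul]
      rw [hs i]; exact tsum_mul_left
    rw [this]; exact hu'.const_smul c

/-- The (possibly unbounded) operator of a matrix in `ℓ²(ℤ^d)`, on its maximal domain. -/
def matOp (A : Matrix (Lat d) (Lat d) ℂ) : ell2 d →ₗ.[ℂ] ell2 d where
  domain := matDomain A
  toFun :=
    { toFun := fun u => ⟨matAct A u.1, u.2.2⟩
      map_add' := by
        rintro ⟨u, hu, hu'⟩ ⟨v, hv, hv'⟩
        apply Subtype.ext
        funext i
        change (∑' j, A i j * (u + v) j) = (∑' j, A i j * u j) + ∑' j, A i j * v j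
        rw [← (hu i).tsum_add (hv i)]
        refine tsum_congr fun j => ?_
        simp [mul_add]
      map_smul' := by
        rintro c ⟨u, hu, hu'⟩
        apply Subtype.ext
        funext i
        change (∑' j, A i j * (c • u) j) = c * ∑' j, A i j * u j
        rw [← tsum_mul_left]
        refine tsum_congr fun j => ?_
        simp; ring }

/-- `e` is an eigenvector of the operator `H` with eigenvalue `z`. -/
def IsEigenvector (H : ell2 d →ₗ.[ℂ] ell2 d) (z : ℂ) (e : ell2 d) : Prop :=
  e ≠ 0 ∧ ∃ h : e ∈ H.domain, H ⟨e, h⟩ = z • e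

/-- `H` has pure point spectrum: the finite linear combinations of its eigenvectors are dense. -/
def HasPurePointSpectrum (H : ell2 d →ₗ.[ℂ] ell2 d) : Prop :=
  (Submodule.span ℂ {e | ∃ z, IsEigenvector H z e}).topologicalClosure = ⊤

/-- A complete set of eigenfunctions of `H`, indexed by `ℤ^d`: each `e_k` is an eigenvector, and
the finite linear combinations of the `e_k` are dense. -/
def IsCompleteEigenfamily (H : ell2 d →ₗ.[ℂ] ell2 d) (e : Lat d → ell2 d) : Prop :=
  (∀ k, ∃ z, IsEigenvector H z (e k)) ∧
    (Submodule.span ℂ (Set.range e)).topologicalClosure = ⊤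

/-- The spectrum of a possibly unbounded operator: `z` is not in the spectrum if `H - z` maps the
domain of `H` bijectively onto the whole space, with a bounded inverse `R`. -/
def opSpectrum (H : ell2 d →ₗ.[ℂ] ell2 d) : Set ℂ :=
  {z | ¬ ∃ R : ell2 d →L[ℂ] ell2 d,
    (∀ v, ∃ h : R v ∈ H.domain, H ⟨R v, h⟩ - z • R v = v) ∧
      ∀ u : H.domain, R (H u - z • (u : ell2 d)) = u}

end PowerLaw

end

open PowerLaw

/-! The aim is a bounded `Q` close to `1` and a small diagonal `V` with `(T + V + D) Q = Q D`. The
columns of `Q` are then eigenfunctions of `H' = T + V + D` with eigenvalues `d_k`. Invertibility of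
`Q` makes them complete, and the Sobolev bound on `Q - 1` makes them decay.

`Q` and `V` come from a Newton iteration on the residual `F = (T + V) Q + [D, Q]`. One step removes
the diagonal of `F` by changing `V` and cancels the rest by `Q ↦ Q (1 + W)` with `[D, W] = -(F -
diag F)`; distality bounds the divisors `d_i - d_j`. By `resid_step` the new residual consists of
products of two small factors and the newly admitted hops.

No derivatives are lost, because step `n` uses only hops of length at most `3 ^ n`. The residual
then has width `2 * 3 ^ n`, so the divisors cost at most `γ⁻¹ (2 * 3 ^ n) ^ τ`. Since `T` is
controlled with `τ + σ` more powers of the weight than the working norm of index `t`, the neglected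
hops are of size `ρ ^ n`, `ρ = 3 ^ (-(τ + σ))`. So the residuals decay like `ρ ^ n` and the
corrections like `q ^ n`, `q = 3 ^ (-σ)`, all in the single norm `t` (`normLe_Q_F`). Convergence is
only geometric, which is enough.

As `φ 0 = 0`, hops never contribute to the diagonal, so the counterterm is quadratic in the size of
`T` (`extNorm_diag_F_le`). This yields both estimates of `D - D'`.

`D` may be unbounded, so the iteration takes place among column-finite matrices, where all products
exist and associate. Only `Q` and `T + V` are extended to `ℓ²` and passed to the limit
(`exists_conjugation`). For real `D`, `exists_eq_conj` shows that `Q` carries the domain of `D` onto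
that of `H'`, so the two operators are similar and have equal spectra. -/

open scoped ENNReal Topology
open Filter PowerLaw

namespace PowerLaw
variable {d : ℕ}

/-! ### The `ℓ²` norm in `ℝ≥0∞`. -/

/-- The `ℓ²` norm of an extended nonnegative function. -/
noncomputable def l2 {ι : Type*} (f : ι → ℝ≥0∞) : ℝ≥0∞ := (∑' k, f k ^ 2) ^ (1 / 2 : ℝ)

theorem l2_sq {ι : Type*} (f : ι → ℝ≥0∞) : l2 f ^ 2 = ∑' k, f k ^ 2 := by
  rw [l2, ← ENNReal.rpow_natCast, ← ENNReal.rpow_mul]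
  norm_num

theorem l2_le_of_sq_le {ι : Type*} {f : ι → ℝ≥0∞} {c : ℝ≥0∞} (h : ∑' k, f k ^ 2 ≤ c ^ 2) :
    l2 f ≤ c := by
  rw [← l2_sq] at h
  exact (ENNReal.pow_le_pow_left_iff two_ne_zero).1 h

theorem l2_mono {ι : Type*} {f g : ι → ℝ≥0∞} (h : ∀ k, f k ≤ g k) : l2 f ≤ l2 g := by
  apply l2_le_of_sq_le
  rw [l2_sq]
  exact ENNReal.tsum_le_tsum fun k => pow_le_pow_left₀ zero_le (h k) 2

theorem le_l2 {ι : Type*} (f : ι → ℝ≥0∞) (k : ι) : f k ≤ l2 f := by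
  rw [← ENNReal.pow_le_pow_left_iff two_ne_zero, l2_sq]
  exact ENNReal.le_tsum k

theorem l2_const_mul {ι : Type*} (c : ℝ≥0∞) (f : ι → ℝ≥0∞) :
    l2 (fun k => c * f k) = c * l2 f := by
  apply (ENNReal.pow_right_strictMono two_ne_zero).injective
  simp only [mul_pow, l2_sq, ← ENNReal.tsum_mul_left]

theorem tsum_mul_le_l2 {ι : Type*} (f g : ι → ℝ≥0∞) : ∑' k, f k * g k ≤ l2 f * l2 g := by
  let _ : MeasurableSpace ι := ⊤
  have h := ENNReal.lintegral_mul_le_Lp_mul_Lq (MeasureTheory.Measure.count : MeasureTheory.Measure ι)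
    (p := 2) (q := 2) ⟨by norm_num, by norm_num, by norm_num⟩
    (f := f) (g := g) measurable_from_top.aemeasurable measurable_from_top.aemeasurable
  simpa [MeasureTheory.lintegral_count, l2] using h

theorem l2_add_le {ι : Type*} (f g : ι → ℝ≥0∞) : l2 (fun k => f k + g k) ≤ l2 f + l2 g := by
  apply l2_le_of_sq_le
  have h := tsum_mul_le_l2 f g
  calc ∑' k, (f k + g k) ^ 2 = ∑' k, f k ^ 2 + 2 * ∑' k, f k * g k + ∑' k, g k ^ 2 := by
        rw [← ENNReal.tsum_mul_left, ← ENNReal.tsum_add, ← ENNReal.tsum_add]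
        exact tsum_congr fun k => by ring
    _ ≤ l2 f ^ 2 + 2 * (l2 f * l2 g) + l2 g ^ 2 := by
        rw [l2_sq, l2_sq]; gcongr
    _ = _ := by ring

/-! ### Weights on the lattice and the weighted convolution inequality. -/

theorem one_le_bracket (k : Lat d) : 1 ≤ bracket k := le_max_left _ _

theorem bracket_pos (k : Lat d) : 0 < bracket k := zero_lt_one.trans_le (one_le_bracket k)

theorem norm_le_bracket (k : Lat d) : ‖k‖ ≤ bracket k := le_max_right _ _

theorem one_le_norm {k : Lat d} (hk : k ≠ 0) : 1 ≤ ‖k‖ := by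
  obtain ⟨v, hv⟩ := Function.ne_iff.1 hk
  refine le_trans ?_ (norm_le_pi_norm k v)
  rw [Int.norm_eq_abs]
  exact_mod_cast Int.one_le_abs hv

theorem bracket_eq_norm {k : Lat d} (hk : k ≠ 0) : bracket k = ‖k‖ := max_eq_right (one_le_norm hk)

theorem bracket_zero : bracket (0 : Lat d) = 1 := by simp [bracket]

/-- `ℤ^d` embeds isometrically in the standard lattice of `ℝ^d`, where the criterion for lattice
sums applies. The bracket differs from the norm only at `0`, which the indicator term covers. -/
theorem summable_bracket_rpow {a : ℝ} (ha : (d : ℝ) < a) :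
    Summable fun k : Lat d => bracket k ^ (-a) := by
  have ha0 : 0 < a := (Nat.cast_nonneg d).trans_lt ha
  let b := Pi.basisFun ℝ (Fin d)
  let L := Submodule.span ℤ (Set.range b)
  have hmem : ∀ k : Lat d, (fun v => (k v : ℝ)) ∈ L := by
    intro k
    rw [Module.Basis.mem_span_iff_repr_mem]
    intro v
    exact ⟨k v, by simp [b]⟩
  let f : Lat d → L := fun k => ⟨_, hmem k⟩
  have hf : Function.Injective f := by
    intro k l h
    funext v
    have : (k v : ℝ) = l v := congrFun (congrArg Subtype.val h) v
    exact_mod_cast this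
  have hn : ∀ k, ‖f k‖ = ‖k‖ := by
    intro k
    change ‖(fun v => (k v : ℝ))‖ = ‖k‖
    simp only [Pi.norm_def]
    congr 1
  have hrank : Module.finrank ℤ L = d := by
    rw [ZLattice.rank ℝ L]; simp
  have h := (ZLattice.summable_norm_rpow L (-a) (by rw [hrank]; linarith)).comp_injective hf
  have h1 : Summable fun k : Lat d => if k = 0 then (1 : ℝ) else 0 :=
    summable_of_ne_finset_zero (s := {0}) fun k hk => by simp at hk; simp [hk]
  refine Summable.of_nonneg_of_le (fun k => (Real.rpow_pos_of_pos (bracket_pos k) _).le) ?_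
    (h.add h1)
  intro k
  by_cases hk : k = 0
  · subst hk
    simp only [bracket_zero, Real.one_rpow, Function.comp, if_true]
    have := Real.rpow_nonneg (norm_nonneg (f 0)) (-a)
    linarith
  · simp [Function.comp, hn, hk, bracket_eq_norm hk]

/-- The weight `⟨k⟩^t` in `ℝ≥0∞`. -/
noncomputable def wt (t : ℝ) (k : Lat d) : ℝ≥0∞ := ENNReal.ofReal (bracket k ^ t)

theorem wt_ne_zero (t : ℝ) (k : Lat d) : wt t k ≠ 0 := by
  simpa [wt] using Real.rpow_pos_of_pos (bracket_pos k) t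

theorem wt_sq (t : ℝ) (k : Lat d) : wt t k ^ 2 = wt (2 * t) k := by
  rw [wt, wt, ← ENNReal.ofReal_pow (Real.rpow_nonneg (bracket_pos k).le _), ← Real.rpow_natCast,
    ← Real.rpow_mul (bracket_pos k).le]
  congr 2
  push_cast; ring

theorem wt_mul (t t' : ℝ) (k : Lat d) : wt t k * wt t' k = wt (t + t') k := by
  rw [wt, wt, wt, ← ENNReal.ofReal_mul (Real.rpow_nonneg (bracket_pos k).le _),
    Real.rpow_add (bracket_pos k)]

theorem wt_zero_exp (k : Lat d) : wt 0 k = 1 := by simp [wt]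

theorem wt_at_zero (t : ℝ) : wt t (0 : Lat d) = 1 := by simp [wt, bracket_zero]

theorem bracket_add_le (k l : Lat d) : bracket (k + l) ≤ 2 * max (bracket k) (bracket l) := by
  have h1 := le_max_left (bracket k) (bracket l)
  have h2 := le_max_right (bracket k) (bracket l)
  have h3 := one_le_bracket k
  refine max_le (by linarith) ((norm_add_le k l).trans ?_)
  linarith [norm_le_bracket k, norm_le_bracket l]

/-- The larger of the two brackets is at least half of `⟨k + l⟩`, so its weight can be traded for
the weight at `k + l` while the other factor is kept. -/
theorem wt_conv_le {t : ℝ} (ht : 0 ≤ t) (k l : Lat d) :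
    wt (-t) k * wt (-t) l ≤ ENNReal.ofReal (2 ^ t) * wt (-t) (k + l) * (wt (-t) k + wt (-t) l) := by
  have key : ∀ k l : Lat d, bracket k ≤ bracket l → wt (-t) l ≤
      ENNReal.ofReal (2 ^ t) * wt (-t) (k + l) := by
    intro k l h
    rw [wt, wt, ← ENNReal.ofReal_mul (by positivity)]
    apply ENNReal.ofReal_le_ofReal
    have h1 : bracket (k + l) ≤ 2 * bracket l := by
      simpa [max_eq_right h] using bracket_add_le k l
    rw [Real.rpow_neg (bracket_pos _).le, Real.rpow_neg (bracket_pos _).le, ← div_eq_mul_inv,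
      le_div_iff₀ (Real.rpow_pos_of_pos (bracket_pos _) _), inv_mul_le_iff₀
      (Real.rpow_pos_of_pos (bracket_pos _) _), mul_comm,
      ← Real.mul_rpow (by norm_num) (bracket_pos _).le]
    exact Real.rpow_le_rpow (bracket_pos _).le h1 ht
  rcases le_total (bracket k) (bracket l) with h | h
  · calc _ ≤ wt (-t) k * (ENNReal.ofReal (2 ^ t) * wt (-t) (k + l)) := by gcongr; exact key k l h
      _ = ENNReal.ofReal (2 ^ t) * wt (-t) (k + l) * wt (-t) k := by ring
      _ ≤ _ := by gcongr; exact le_self_add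
  · calc _ ≤ (ENNReal.ofReal (2 ^ t) * wt (-t) (k + l)) * wt (-t) l := by
          gcongr; rw [add_comm]; exact key l k h
      _ ≤ _ := by gcongr; exact le_add_self

/-- The sum of the weights `⟨k⟩^{-2t}`. -/
noncomputable def wtSum (d : ℕ) (t : ℝ) : ℝ≥0∞ := ∑' k : Lat d, wt (-(2 * t)) k

theorem wtSum_ne_top {t : ℝ} (ht : (d : ℝ) / 2 < t) : wtSum d t ≠ ∞ := by
  refine (summable_bracket_rpow (d := d) (a := 2 * t) (by linarith)).tsum_ofReal_ne_top

theorem sum_wt_conv_le {t : ℝ} (ht : 0 ≤ t) (k : Lat d) :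
    ∑' l, wt (-(2 * t)) l * wt (-(2 * t)) (k - l) ≤
      ENNReal.ofReal (2 ^ (2 * t)) * 2 * wtSum d t * wt (-(2 * t)) k := by
  calc _ ≤ ∑' l, ENNReal.ofReal (2 ^ (2 * t)) * wt (-(2 * t)) k *
        (wt (-(2 * t)) l + wt (-(2 * t)) (k - l)) := by
        refine ENNReal.tsum_le_tsum fun l => ?_
        simpa using wt_conv_le (t := 2 * t) (by linarith) l (k - l)
    _ = ENNReal.ofReal (2 ^ (2 * t)) * wt (-(2 * t)) k * (wtSum d t + wtSum d t) := by
        rw [ENNReal.tsum_mul_left, ENNReal.tsum_add]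
        congr 2
        exact (Equiv.subLeft k).tsum_eq (fun l => wt (-(2 * t)) l)
    _ = _ := by ring

/-- The constant of the algebra property of the Sobolev norms. -/
noncomputable def algConst (d : ℕ) (t : ℝ) : ℝ≥0∞ :=
  (ENNReal.ofReal (2 ^ (2 * t)) * 2 * wtSum d t) ^ (1 / 2 : ℝ)

theorem algConst_ne_top {t : ℝ} (ht : (d : ℝ) / 2 < t) : algConst d t ≠ ∞ :=
  ENNReal.rpow_ne_top_of_nonneg (by norm_num) (ENNReal.mul_ne_top
    (ENNReal.mul_ne_top ENNReal.ofReal_ne_top (by norm_num)) (wtSum_ne_top ht))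

/-- Cauchy–Schwarz against `⟨l⟩^{-t} ⟨k - l⟩^{-t}`, whose squares sum over `l` to a multiple of
`⟨k⟩^{-2t}`, leaves a convolution of the squared weighted sequences, and this is summed by Tonelli.
It makes the Sobolev norms submultiplicative up to `algConst`. -/
theorem l2_conv_le {t : ℝ} (ht : 0 ≤ t) (a b : Lat d → ℝ≥0∞) :
    l2 (fun k => (∑' l, a l * b (k - l)) * wt t k) ≤
      algConst d t * (l2 (fun k => a k * wt t k) * l2 (fun k => b k * wt t k)) := by
  set a' := fun k => a k * wt t k with ha'
  set b' := fun k => b k * wt t k with hb'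
  have hw : ∀ k : Lat d, wt t k * wt (-t) k = 1 := fun k => by
    rw [wt_mul, add_neg_cancel, wt_zero_exp]
  have hw2 : ∀ k : Lat d, wt (-t) k ^ 2 = wt (-(2 * t)) k := fun k => by
    rw [wt_sq]; congr 1; ring
  have hpt : ∀ k, ((∑' l, a l * b (k - l)) * wt t k) ^ 2 ≤
      algConst d t ^ 2 * ∑' l, (a' l * b' (k - l)) ^ 2 := by
    intro k
    have h1 : ∑' l, a l * b (k - l) =
        ∑' l, (a' l * b' (k - l)) * (wt (-t) l * wt (-t) (k - l)) := by
      refine tsum_congr fun l => ?_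
      calc a l * b (k - l) = a l * b (k - l) * (wt t l * wt (-t) l) *
            (wt t (k - l) * wt (-t) (k - l)) := by rw [hw, hw]; ring
        _ = _ := by simp only [ha', hb']; ring
    have h2 := tsum_mul_le_l2 (fun l => a' l * b' (k - l)) (fun l => wt (-t) l * wt (-t) (k - l))
    have h3 : l2 (fun l => wt (-t) l * wt (-t) (k - l)) ^ 2 ≤
        algConst d t ^ 2 * wt (-(2 * t)) k := by
      rw [l2_sq, algConst, ← ENNReal.rpow_natCast _ 2, ← ENNReal.rpow_mul]
      norm_num only [ENNReal.rpow_one]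
      simpa only [mul_pow, hw2] using sum_wt_conv_le ht k
    rw [mul_pow, h1]
    calc _ ≤ (l2 (fun l => a' l * b' (k - l)) * l2 (fun l => wt (-t) l * wt (-t) (k - l))) ^ 2 *
          wt t k ^ 2 := by gcongr
      _ = (∑' l, (a' l * b' (k - l)) ^ 2) *
          l2 (fun l => wt (-t) l * wt (-t) (k - l)) ^ 2 * wt t k ^ 2 := by
          rw [mul_pow, l2_sq]
      _ ≤ (∑' l, (a' l * b' (k - l)) ^ 2) * (algConst d t ^ 2 * wt (-(2 * t)) k) * wt t k ^ 2 := by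
          gcongr
      _ = (algConst d t ^ 2 * ∑' l, (a' l * b' (k - l)) ^ 2) * (wt t k * wt (-t) k) ^ 2 := by
          rw [← hw2]; ring
      _ = _ := by rw [hw]; ring
  apply l2_le_of_sq_le
  calc _ ≤ ∑' k, algConst d t ^ 2 * ∑' l, (a' l * b' (k - l)) ^ 2 := ENNReal.tsum_le_tsum hpt
    _ = algConst d t ^ 2 * ∑' l, a' l ^ 2 * ∑' k, b' (k - l) ^ 2 := by
        rw [ENNReal.tsum_mul_left, ENNReal.tsum_comm]
        congr 1
        refine tsum_congr fun l => ?_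
        rw [← ENNReal.tsum_mul_left]
        exact tsum_congr fun k => mul_pow _ _ _
    _ = algConst d t ^ 2 * ∑' l, a' l ^ 2 * ∑' k, b' k ^ 2 := by
        congr 1
        refine tsum_congr fun l => ?_
        congr 1
        exact (Equiv.subRight l).tsum_eq (fun k => b' k ^ 2)
    _ = _ := by rw [ENNReal.tsum_mul_right, mul_pow, mul_pow, l2_sq, l2_sq]

theorem tsum_le_l2_wt {t : ℝ} (a : Lat d → ℝ≥0∞) :
    ∑' k, a k ≤ wtSum d t ^ (1 / 2 : ℝ) * l2 (fun k => a k * wt t k) := by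
  have h := tsum_mul_le_l2 (fun k => wt (-t) k) (fun k => a k * wt t k)
  have h1 : l2 (fun k : Lat d => wt (-t) k) = wtSum d t ^ (1 / 2 : ℝ) := by
    rw [l2, wtSum]
    congr 2; funext k; rw [wt_sq]; congr 1; ring
  rw [h1] at h
  refine le_trans (le_of_eq (tsum_congr fun k => ?_)) h
  rw [mul_left_comm, wt_mul, neg_add_cancel, wt_zero_exp, mul_one]

/-! ### The extended norm of the sequence algebra and the Sobolev norm. -/

namespace TransInvBanachAlgebra
variable (B : TransInvBanachAlgebra d)

theorem extNorm_of_mem {a : Lat d → ℂ} (h : a ∈ B.carrier) :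
    B.extNorm a = ENNReal.ofReal (B.nrm ⟨a, h⟩) := dif_pos h

theorem mem_of_extNorm_ne_top {a : Lat d → ℂ} (h : B.extNorm a ≠ ∞) : a ∈ B.carrier := by
  by_contra h'
  exact h (dif_neg h')

theorem extNorm_of_notMem {a : Lat d → ℂ} (h : a ∉ B.carrier) : B.extNorm a = ∞ := dif_neg h

theorem extNorm_zero : B.extNorm 0 = 0 := by
  rw [B.extNorm_of_mem B.carrier.zero_mem]
  have : (⟨0, B.carrier.zero_mem⟩ : B.carrier) = 0 := rfl
  rw [this, map_zero, ENNReal.ofReal_zero]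

theorem extNorm_pos {a : Lat d → ℂ} (h : a ≠ 0) : B.extNorm a ≠ 0 := by
  by_cases ha : a ∈ B.carrier
  · rw [B.extNorm_of_mem ha, Ne, ENNReal.ofReal_eq_zero, not_le]
    refine lt_of_le_of_ne (apply_nonneg _ _) fun h0 => h ?_
    exact congrArg Subtype.val (B.nrm.eq_zero_of_map_eq_zero' _ h0.symm)
  · rw [extNorm, dif_neg ha]; simp

theorem extNorm_add_le (a b : Lat d → ℂ) : B.extNorm (a + b) ≤ B.extNorm a + B.extNorm b := by
  by_cases ha : a ∈ B.carrier
  · by_cases hb : b ∈ B.carrier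
    · rw [B.extNorm_of_mem ha, B.extNorm_of_mem hb, B.extNorm_of_mem (B.carrier.add_mem ha hb),
        ← ENNReal.ofReal_add (apply_nonneg _ _) (apply_nonneg _ _)]
      exact ENNReal.ofReal_le_ofReal (map_add_le_add B.nrm ⟨a, ha⟩ ⟨b, hb⟩)
    · rw [B.extNorm_of_notMem hb]; simp
  · rw [B.extNorm_of_notMem ha]; simp

theorem extNorm_neg (a : Lat d → ℂ) : B.extNorm (-a) = B.extNorm a := by
  by_cases ha : a ∈ B.carrier
  · rw [B.extNorm_of_mem ha, B.extNorm_of_mem (B.carrier.neg_mem ha)]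
    exact congrArg _ (map_neg_eq_map B.nrm ⟨a, ha⟩)
  · rw [extNorm, extNorm, dif_neg ha, dif_neg]
    rwa [neg_mem_iff]

theorem extNorm_mul_le (a b : Lat d → ℂ) : B.extNorm (a * b) ≤ B.extNorm a * B.extNorm b := by
  -- Zero factors are set apart because `0 * ∞ = 0`; otherwise a factor outside the algebra makes
  -- the right side `∞`.
  by_cases ha0 : a = 0
  · simp [ha0, extNorm_zero]
  by_cases hb0 : b = 0
  · simp [hb0, extNorm_zero]
  by_cases ha : a ∈ B.carrier
  · by_cases hb : b ∈ B.carrier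
    · rw [B.extNorm_of_mem ha, B.extNorm_of_mem hb, B.extNorm_of_mem (B.carrier.mul_mem ha hb),
        ← ENNReal.ofReal_mul (apply_nonneg _ _)]
      exact ENNReal.ofReal_le_ofReal (map_mul_le_mul B.nrm ⟨a, ha⟩ ⟨b, hb⟩)
    · rw [B.extNorm_of_notMem hb, ENNReal.mul_top (B.extNorm_pos ha0)]; simp
  · rw [B.extNorm_of_notMem ha, ENNReal.top_mul (B.extNorm_pos hb0)]; simp

theorem extNorm_sum_le {ι : Type*} (s : Finset ι) (a : ι → Lat d → ℂ) :
    B.extNorm (∑ l ∈ s, a l) ≤ ∑ l ∈ s, B.extNorm (a l) :=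
  Finset.le_sum_of_subadditive _ B.extNorm_zero.le B.extNorm_add_le s a

theorem extNorm_shift_le (j : Lat d) (a : Lat d → ℂ) : B.extNorm (shift j a) ≤ B.extNorm a := by
  by_cases ha : a ∈ B.carrier
  · rw [B.extNorm_of_mem ha, B.extNorm_of_mem (B.shift_mem j a ha)]
    exact (congrArg _ (B.nrm_shift j ⟨a, ha⟩)).le
  · rw [B.extNorm_of_notMem ha]; simp

theorem extNorm_const (c : ℂ) : B.extNorm (fun _ => c) = ENNReal.ofReal ‖c‖ := by
  have h : (fun _ => c) ∈ B.carrier := B.carrier.algebraMap_mem c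
  rw [B.extNorm_of_mem h]
  have : (⟨_, h⟩ : B.carrier) = c • 1 := by
    apply Subtype.ext; funext i; simp
  rw [this, map_smul_eq_mul, B.nrm_one, mul_one]

/-- The carrier of the algebra, as a type that carries the norm. -/
def Elem : Type := B.carrier

noncomputable instance : NormedRing B.Elem := RingNorm.toNormedRing (R := B.carrier) B.nrm.toRingNorm

noncomputable instance : NormedAlgebra ℂ B.Elem :=
  { (inferInstance : Algebra ℂ B.carrier) with
    norm_smul_le := fun r x => (map_smul_eq_mul B.nrm r x).le }

instance : NormOneClass B.Elem := ⟨B.nrm_one⟩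

instance : CompleteSpace B.Elem := by
  refine Metric.complete_of_cauchySeq_tendsto fun u hu => ?_
  obtain ⟨a, ha⟩ := B.complete u fun ε hε => by
    obtain ⟨N, hN⟩ := Metric.cauchySeq_iff.1 hu ε hε
    refine ⟨N, fun m hm n hn => ?_⟩
    have := hN m hm n hn
    rwa [dist_eq_norm] at this
  exact ⟨a, tendsto_iff_norm_sub_tendsto_zero.2 ha⟩

/-- The inclusion of the algebra in the space of all sequences. -/
def Elem.val : B.Elem →ₐ[ℂ] (Lat d → ℂ) := B.carrier.val

theorem Elem.extNorm_val (a : B.Elem) : B.extNorm (Elem.val B a) = ENNReal.ofReal ‖a‖ :=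
  B.extNorm_of_mem (Subtype.property (p := fun x => x ∈ B.carrier) a)

/-- Evaluation at `i` is a character of a complete unital Banach algebra and hence contractive. So
the norm dominates the sup norm, which links the abstract algebra to entries and to operators on
`ℓ²`. -/
theorem Elem.norm_val_apply_le (a : B.Elem) (i : Lat d) : ‖Elem.val B a i‖ ≤ ‖a‖ :=
  AlgHom.norm_apply_le_self ((Pi.evalAlgHom ℂ (fun _ : Lat d => ℂ) i).comp (Elem.val B)) a

theorem norm_apply_le_extNorm (a : Lat d → ℂ) (i : Lat d) :
    ENNReal.ofReal ‖a i‖ ≤ B.extNorm a := by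
  by_cases ha : a ∈ B.carrier
  · rw [B.extNorm_of_mem ha]
    exact ENNReal.ofReal_le_ofReal (Elem.norm_val_apply_le B (⟨a, ha⟩ : B.carrier) i)
  · rw [extNorm, dif_neg ha]; simp

/-- A series of sequences with summable norms converges in the algebra. -/
theorem exists_limit {u : ℕ → Lat d → ℂ} {b : ℕ → ℝ} (hb : Summable b) (hb0 : ∀ n, 0 ≤ b n)
    (h0 : u 0 = 0) (hu : ∀ n, B.extNorm (u (n + 1) - u n) ≤ ENNReal.ofReal (b n)) :
    ∃ a : Lat d → ℂ, B.extNorm a ≤ ENNReal.ofReal (∑' n, b n) ∧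
      Tendsto (fun n => B.extNorm (u n - a)) atTop (𝓝 0) := by
  have hd : ∀ n, u (n + 1) - u n ∈ B.carrier := fun n =>
    B.mem_of_extNorm_ne_top ((hu n).trans_lt ENNReal.ofReal_lt_top).ne
  let w : ℕ → B.Elem := fun n => (⟨_, hd n⟩ : B.carrier)
  have hval : ∀ n, Elem.val B (w n) = u (n + 1) - u n := fun n => rfl
  have hw : ∀ n, ‖w n‖ ≤ b n := by
    intro n
    have := hu n
    rwa [← hval, Elem.extNorm_val, ENNReal.ofReal_le_ofReal_iff (hb0 n)] at this
  have hsum : ∀ n, Elem.val B (∑ m ∈ Finset.range n, w m) = u n := by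
    intro n
    induction n with
    | zero => simp [h0]
    | succ n ih => rw [Finset.sum_range_succ, map_add, ih, hval]; simp
  have hs : Summable w := Summable.of_norm_bounded hb hw
  refine ⟨Elem.val B (∑' n, w n), ?_, ?_⟩
  · rw [Elem.extNorm_val]
    exact ENNReal.ofReal_le_ofReal (tsum_of_norm_bounded hb.hasSum hw)
  · have h1 := tendsto_iff_norm_sub_tendsto_zero.1 hs.hasSum.tendsto_sum_nat
    have h2 := ENNReal.tendsto_ofReal h1
    rw [ENNReal.ofReal_zero] at h2
    refine h2.congr fun n => ?_
    rw [← hsum n, ← map_sub, Elem.extNorm_val]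

theorem sobNorm_eq_l2 (A : Matrix (Lat d) (Lat d) ℂ) (t : ℝ) :
    B.sobNorm A t = l2 (fun k => B.extNorm (kDiag A k) * wt t k) := by
  simp only [sobNorm, l2, mul_pow, wt_sq]
  rfl

theorem sobNorm_le_mul {A A' : Matrix (Lat d) (Lat d) ℂ} {t t' : ℝ} {c : ℝ≥0∞}
    (h : ∀ k, B.extNorm (kDiag A k) * wt t k ≤ c * (B.extNorm (kDiag A' k) * wt t' k)) :
    B.sobNorm A t ≤ c * B.sobNorm A' t' := by
  rw [sobNorm_eq_l2, sobNorm_eq_l2, ← l2_const_mul]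
  exact l2_mono h

theorem extNorm_kDiag_le (A : Matrix (Lat d) (Lat d) ℂ) (t : ℝ) (k : Lat d) :
    B.extNorm (kDiag A k) * wt t k ≤ B.sobNorm A t := by
  rw [sobNorm_eq_l2]
  exact le_l2 _ k

theorem sobNorm_add_le (A A' : Matrix (Lat d) (Lat d) ℂ) (t : ℝ) :
    B.sobNorm (A + A') t ≤ B.sobNorm A t + B.sobNorm A' t := by
  simp only [sobNorm_eq_l2]
  refine (l2_mono fun k => ?_).trans (l2_add_le _ _)
  rw [← add_mul]
  gcongr
  exact B.extNorm_add_le _ _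

theorem sobNorm_of_diagonal {A : Matrix (Lat d) (Lat d) ℂ} (hA : ∀ i j, i ≠ j → A i j = 0)
    (t : ℝ) : B.sobNorm A t = B.extNorm (kDiag A 0) := by
  apply (ENNReal.pow_right_strictMono two_ne_zero).injective
  simp only [sobNorm_eq_l2, l2_sq]
  rw [tsum_eq_single 0]
  · rw [wt_at_zero, mul_one]
  · intro k hk
    have : kDiag A k = 0 := by
      funext i
      exact hA _ _ fun h => hk (by simpa using h.symm)
    rw [this, extNorm_zero]; simp

end TransInvBanachAlgebra

/-! ### Column-finite matrices, band width and diagonals. -/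

/-- The algebra of operators on finitely supported sequences, i.e. of column-finite matrices. -/
def Op (d : ℕ) : Type := Module.End ℂ (Lat d →₀ ℂ)

noncomputable instance : Ring (Op d) := inferInstanceAs (Ring (Module.End ℂ (Lat d →₀ ℂ)))

instance : FunLike (Op d) (Lat d →₀ ℂ) (Lat d →₀ ℂ) :=
  inferInstanceAs (FunLike (Module.End ℂ (Lat d →₀ ℂ)) (Lat d →₀ ℂ) (Lat d →₀ ℂ))

instance : LinearMapClass (Op d) ℂ (Lat d →₀ ℂ) (Lat d →₀ ℂ) :=
  inferInstanceAs (LinearMapClass (Module.End ℂ (Lat d →₀ ℂ)) ℂ (Lat d →₀ ℂ) (Lat d →₀ ℂ))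

theorem Op.mul_apply (A A' : Op d) (f : Lat d →₀ ℂ) : (A * A') f = A (A' f) := rfl

theorem Op.one_apply (f : Lat d →₀ ℂ) : (1 : Op d) f = f := rfl

/-- The matrix of an operator. -/
noncomputable def entry (A : Op d) : Matrix (Lat d) (Lat d) ℂ := fun i j => A (Finsupp.single j 1) i

theorem Op.ext_entry {A A' : Op d} (h : ∀ i j, entry A i j = entry A' i j) : A = A' := by
  apply Finsupp.lhom_ext'
  intro j
  ext i
  exact h i j

@[simp] theorem entry_add (A A' : Op d) : entry (A + A') = entry A + entry A' := rfl
@[simp] theorem entry_sub (A A' : Op d) : entry (A - A') = entry A - entry A' := rfl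
@[simp] theorem entry_neg (A : Op d) : entry (-A) = -entry A := rfl
theorem entry_one (i j : Lat d) : entry (1 : Op d) i j = if i = j then 1 else 0 := by
  simp [entry, Op.one_apply, Finsupp.single_apply, eq_comm]

theorem hasSum_apply (A : Op d) (f : Lat d →₀ ℂ) (i : Lat d) :
    HasSum (fun m => entry A i m * f m) (A f i) := by
  have h : A f i = ∑ m ∈ f.support, entry A i m * f m := by
    conv_lhs => rw [← f.sum_single]
    rw [Finsupp.sum, map_sum, Finsupp.finsetSum_apply]
    refine Finset.sum_congr rfl fun m _ => ?_
    have : Finsupp.single m (f m) = f m • Finsupp.single m (1 : ℂ) := by simp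
    rw [this, map_smul, Finsupp.smul_apply, smul_eq_mul, mul_comm]
    rfl
  rw [h]
  exact hasSum_sum_of_ne_finset_zero fun m hm => by
    rw [Finsupp.notMem_support_iff.1 hm, mul_zero]

/-- All entries of the operator at distance more than `N` from the diagonal are zero. -/
def Band (A : Op d) (N : ℝ) : Prop := ∀ i j, N < ‖i - j‖ → entry A i j = 0

theorem Band.mono {A : Op d} {N M : ℝ} (h : Band A N) (hNM : N ≤ M) : Band A M :=
  fun i j hij => h i j (hNM.trans_lt hij)

theorem Band.add {A A' : Op d} {N : ℝ} (h : Band A N) (h' : Band A' N) : Band (A + A') N :=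
  fun i j hij => by rw [entry_add, Matrix.add_apply, h i j hij, h' i j hij, add_zero]

theorem Band.sub {A A' : Op d} {N : ℝ} (h : Band A N) (h' : Band A' N) : Band (A - A') N :=
  fun i j hij => by rw [entry_sub, Matrix.sub_apply, h i j hij, h' i j hij, sub_zero]

theorem Band.mul {A A' : Op d} {N M : ℝ} (h : Band A N) (h' : Band A' M) :
    Band (A * A') (N + M) := by
  intro i j hij
  have h1 := hasSum_apply A (A' (Finsupp.single j 1)) i
  refine h1.unique ?_
  convert hasSum_zero with m
  by_cases hm : N < ‖i - m‖
  · rw [h i m hm, zero_mul]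
  · have : M < ‖m - j‖ := by
      have := norm_sub_le_norm_sub_add_norm_sub i m j
      linarith
    exact mul_eq_zero_of_right _ (h' m j this)

/-- The lattice points of norm at most `N`. -/
noncomputable def latBall (d : ℕ) (N : ℝ) : Finset (Lat d) :=
  (isCompact_closedBall (0 : Lat d) N).finite_of_discrete.toFinset

theorem mem_latBall {N : ℝ} {k : Lat d} : k ∈ latBall d N ↔ ‖k‖ ≤ N := by
  simp [latBall]

/-- The operator whose `k`-diagonal is `a k` for `k ∈ s` and zero otherwise. -/
noncomputable def ofDiags (s : Finset (Lat d)) (a : Lat d → Lat d → ℂ) : Op d :=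
  Finsupp.linearCombination ℂ fun j => ∑ k ∈ s, Finsupp.single (j + k) (a k (j + k))

open Classical in
theorem entry_ofDiags (s : Finset (Lat d)) (a : Lat d → Lat d → ℂ) (i j : Lat d) :
    entry (ofDiags s a) i j = if i - j ∈ s then a (i - j) i else 0 := by
  have h : ∀ k, j + k = i ↔ k = i - j := fun k => by rw [eq_sub_iff_add_eq, add_comm]
  change Finsupp.linearCombination ℂ
    (fun j => ∑ k ∈ s, Finsupp.single (j + k) (a k (j + k))) (Finsupp.single j 1) i = _
  simp only [Finsupp.linearCombination_single, one_smul, Finsupp.finsetSum_apply,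
    Finsupp.single_apply, h, Finset.sum_ite_eq']
  simp

open Classical in
theorem kDiag_ofDiags (s : Finset (Lat d)) (a : Lat d → Lat d → ℂ) (k : Lat d) :
    kDiag (entry (ofDiags s a)) k = if k ∈ s then a k else 0 := by
  funext i
  rw [kDiag, entry_ofDiags, sub_sub_cancel]
  split_ifs <;> rfl

theorem band_ofDiags {s : Finset (Lat d)} {N : ℝ} (hs : ∀ k ∈ s, ‖k‖ ≤ N)
    (a : Lat d → Lat d → ℂ) : Band (ofDiags s a) N := by
  classical
  intro i j hij
  rw [entry_ofDiags, if_neg fun h => (hs _ h).not_gt hij]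

/-- The diagonal operator of a sequence. -/
noncomputable def diagOp (a : Lat d → ℂ) : Op d := ofDiags {0} fun _ => a

theorem entry_diagOp (a : Lat d → ℂ) (i j : Lat d) :
    entry (diagOp a) i j = if i = j then a i else 0 := by
  classical
  rw [diagOp, entry_ofDiags]
  simp [sub_eq_zero]

theorem diagOp_apply (a : Lat d → ℂ) (f : Lat d →₀ ℂ) (i : Lat d) : diagOp a f i = a i * f i := by
  refine (hasSum_apply _ f i).unique ?_
  convert hasSum_single i (fun m hm => ?_) using 1
  · rw [entry_diagOp, if_pos rfl]
  · rw [entry_diagOp, if_neg hm.symm, zero_mul]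

theorem entry_diagOp_mul (a : Lat d → ℂ) (A : Op d) (i j : Lat d) :
    entry (diagOp a * A) i j = a i * entry A i j := diagOp_apply a _ i

theorem entry_mul_diagOp (a : Lat d → ℂ) (A : Op d) (i j : Lat d) :
    entry (A * diagOp a) i j = entry A i j * a j := by
  have : diagOp a (Finsupp.single j 1) = a j • Finsupp.single j (1 : ℂ) := by
    ext i
    rw [diagOp_apply]
    by_cases h : j = i <;> simp [h]
  rw [entry, Op.mul_apply, this, map_smul, Finsupp.smul_apply, smul_eq_mul, mul_comm]
  rfl

theorem kDiag_diagOp (a : Lat d → ℂ) (k : Lat d) :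
    kDiag (entry (diagOp a)) k = if k = 0 then a else 0 := by
  classical
  rw [diagOp, kDiag_ofDiags]
  simp

theorem band_diagOp (a : Lat d → ℂ) {N : ℝ} (hN : 0 ≤ N) : Band (diagOp a) N :=
  band_ofDiags (by simpa using hN) _

theorem diagOp_one : diagOp (1 : Lat d → ℂ) = 1 := by
  apply Op.ext_entry; intro i j; rw [entry_diagOp, entry_one]; rfl

theorem diagOp_sub (a b : Lat d → ℂ) : diagOp (a - b) = diagOp a - diagOp b := by
  apply Op.ext_entry; intro i j
  rw [entry_sub, Matrix.sub_apply]
  simp only [entry_diagOp]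
  split_ifs <;> simp

theorem diagOp_zero : diagOp (0 : Lat d → ℂ) = 0 := by
  simpa using diagOp_sub (0 : Lat d → ℂ) 0

/-- The diagonals multiply as a twisted convolution, `(A A')_k = ∑_l A_l · σ_l A'_{k-l}`, and
translations do not increase the norm. The band condition makes the sum finite, so the triangle
inequality applies. -/
theorem extNorm_kDiag_mul_le (B : TransInvBanachAlgebra d) {A : Op d} {N : ℝ} (hA : Band A N)
    (A' : Op d) (k : Lat d) :
    B.extNorm (kDiag (entry (A * A')) k) ≤
      ∑' l, B.extNorm (kDiag (entry A) l) * B.extNorm (kDiag (entry A') (k - l)) := by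
  have h : kDiag (entry (A * A')) k = ∑ l ∈ latBall d N,
      kDiag (entry A) l * shift l (kDiag (entry A') (k - l)) := by
    funext i
    rw [Finset.sum_apply]
    have h1 := hasSum_apply A (A' (Finsupp.single (i - k) 1)) i
    rw [← (Equiv.subLeft i).hasSum_iff] at h1
    refine h1.unique ?_
    have h2 : ∀ l ∉ latBall d N, ((fun m => entry A i m * A' (Finsupp.single (i - k) 1) m) ∘
        Equiv.subLeft i) l = 0 := fun l hl => by
      have : entry A i (i - l) = 0 := hA _ _ (by simpa [mem_latBall] using hl)
      simp [this]
    convert hasSum_sum_of_ne_finset_zero (L := .unconditional _) h2 using 2 with l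
    · simp only [Pi.mul_apply, kDiag, shift, entry, Function.comp, Equiv.subLeft_apply]
      rw [sub_sub_sub_cancel_right]
  rw [h]
  refine (B.extNorm_sum_le _ _).trans (le_trans (Finset.sum_le_sum fun l _ => ?_)
    (ENNReal.sum_le_tsum (latBall d N)))
  refine (B.extNorm_mul_le _ _).trans ?_
  gcongr
  exact B.extNorm_shift_le _ _

/-! ### Calculus of Sobolev bounds. -/

/-- The operator has Sobolev norm at most the real number `a`. -/
def NormLe (B : TransInvBanachAlgebra d) (t : ℝ) (A : Op d) (a : ℝ) : Prop :=
  0 ≤ a ∧ B.sobNorm (entry A) t ≤ ENNReal.ofReal a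

namespace NormLe
variable {B : TransInvBanachAlgebra d} {t : ℝ} {A A' : Op d} {a a' : ℝ}

theorem mono (h : NormLe B t A a) (haa' : a ≤ a') : NormLe B t A a' :=
  ⟨h.1.trans haa', h.2.trans (ENNReal.ofReal_le_ofReal haa')⟩

/-- The comparison object is a bare matrix: the full hopping matrix need not be column-finite. -/
theorem of_extNorm_le {M : Matrix (Lat d) (Lat d) ℂ} {t' c : ℝ} (hc : 0 ≤ c) (ha : 0 ≤ a)
    (hM : B.sobNorm M t' ≤ ENNReal.ofReal a)
    (h : ∀ k, B.extNorm (kDiag (entry A) k) * wt t k ≤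
      ENNReal.ofReal c * (B.extNorm (kDiag M k) * wt t' k)) : NormLe B t A (c * a) := by
  refine ⟨mul_nonneg hc ha, (B.sobNorm_le_mul h).trans ?_⟩
  rw [ENNReal.ofReal_mul hc]
  gcongr

theorem of_extNorm_le' (hA : NormLe B t A a)
    (h : ∀ k, B.extNorm (kDiag (entry A') k) ≤ B.extNorm (kDiag (entry A) k)) :
    NormLe B t A' a := by
  have := of_extNorm_le (A := A') zero_le_one hA.1 hA.2 fun k => by
    rw [ENNReal.ofReal_one, one_mul]
    gcongr
    exact h k
  simpa using this

theorem add (h : NormLe B t A a) (h' : NormLe B t A' a') : NormLe B t (A + A') (a + a') := by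
  refine ⟨add_nonneg h.1 h'.1, (B.sobNorm_add_le _ _ t).trans ?_⟩
  rw [ENNReal.ofReal_add h.1 h'.1]
  exact add_le_add h.2 h'.2

theorem neg (h : NormLe B t A a) : NormLe B t (-A) a := by
  refine of_extNorm_le' h fun k => le_of_eq ?_
  rw [← B.extNorm_neg]
  congr 1
  funext i
  simp [kDiag]

theorem sub (h : NormLe B t A a) (h' : NormLe B t A' a') : NormLe B t (A - A') (a + a') := by
  rw [sub_eq_add_neg]
  exact h.add h'.neg

theorem zero : NormLe B t 0 0 := by
  refine ⟨le_rfl, ?_⟩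
  refine (B.sobNorm_of_diagonal (A := entry 0) (fun _ _ _ => rfl) t).trans_le ?_
  exact B.extNorm_zero.trans_le (by simp)

theorem mul (ht : (d : ℝ) / 2 < t) {N : ℝ} (hN : Band A N) (h : NormLe B t A a)
    (h' : NormLe B t A' a') : NormLe B t (A * A') ((algConst d t).toReal * (a * a')) := by
  refine ⟨mul_nonneg ENNReal.toReal_nonneg (mul_nonneg h.1 h'.1), ?_⟩
  have ht0 : 0 ≤ t := (div_nonneg (Nat.cast_nonneg d) zero_le_two).trans ht.le
  rw [ENNReal.ofReal_mul ENNReal.toReal_nonneg, ENNReal.ofReal_toReal (algConst_ne_top ht),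
    ENNReal.ofReal_mul h.1, B.sobNorm_eq_l2]
  refine (l2_mono fun k => ?_).trans ((l2_conv_le ht0 (fun k => B.extNorm (kDiag (entry A) k))
    (fun k => B.extNorm (kDiag (entry A') k))).trans ?_)
  · gcongr
    exact extNorm_kDiag_mul_le B hN A' k
  · rw [← B.sobNorm_eq_l2, ← B.sobNorm_eq_l2]
    gcongr
    exacts [h.2, h'.2]

theorem diagOp_iff {v : Lat d → ℂ} :
    NormLe B t (diagOp v) a ↔ 0 ≤ a ∧ B.extNorm v ≤ ENNReal.ofReal a := by
  rw [NormLe, B.sobNorm_of_diagonal, kDiag_diagOp, if_pos rfl]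
  intro i j hij
  rw [entry_diagOp, if_neg hij]

theorem one : NormLe B t 1 1 := by
  rw [← diagOp_one, diagOp_iff]
  refine ⟨zero_le_one, ?_⟩
  have := B.extNorm_const 1
  simp only [norm_one] at this
  exact this.le

theorem extNorm_kDiag_le (h : NormLe B t A a) (k : Lat d) :
    B.extNorm (kDiag (entry A) k) * wt t k ≤ ENNReal.ofReal a :=
  (B.extNorm_kDiag_le _ _ _).trans h.2

theorem extNorm_kDiag_zero_le (h : NormLe B t A a) :
    B.extNorm (kDiag (entry A) 0) ≤ ENNReal.ofReal a := by
  simpa [wt_at_zero] using h.extNorm_kDiag_le 0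

theorem diagPart (h : NormLe B t A a) : NormLe B t (diagOp (kDiag (entry A) 0)) a :=
  diagOp_iff.2 ⟨h.1, h.extNorm_kDiag_zero_le⟩

theorem offDiag (h : NormLe B t A a) : NormLe B t (A - diagOp (kDiag (entry A) 0)) a := by
  refine of_extNorm_le' h fun k => ?_
  by_cases hk : k = 0
  · refine le_of_eq_of_le ?_ zero_le
    rw [← B.extNorm_zero]
    congr 1
    funext i
    simp [hk, kDiag, entry_diagOp]
  · refine le_of_eq ?_
    congr 1
    funext i
    have : i ≠ i - k := fun h => hk (by simpa using h.symm)
    simp [kDiag, entry_diagOp, this]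

theorem norm_entry_le (h : NormLe B t A a) (i j : Lat d) :
    ‖entry A i j‖ ≤ a * bracket (i - j) ^ (-t) := by
  have h1 := h.extNorm_kDiag_le (i - j)
  have h2 := B.norm_apply_le_extNorm (kDiag (entry A) (i - j)) i
  have h3 : ENNReal.ofReal (‖entry A i j‖ * bracket (i - j) ^ t) ≤ ENNReal.ofReal a := by
    rw [ENNReal.ofReal_mul (norm_nonneg _)]
    refine le_trans ?_ h1
    rw [wt]
    gcongr
    simpa [kDiag] using h2
  rw [ENNReal.ofReal_le_ofReal_iff h.1] at h3
  rw [Real.rpow_neg (bracket_pos _).le, ← div_eq_mul_inv,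
    le_div_iff₀ (Real.rpow_pos_of_pos (bracket_pos _) _)]
  exact h3

theorem norm_entry_le' (ht : 0 ≤ t) (h : NormLe B t A a) (i j : Lat d) : ‖entry A i j‖ ≤ a := by
  refine (h.norm_entry_le i j).trans (mul_le_of_le_one_right h.1 ?_)
  exact Real.rpow_le_one_of_one_le_of_nonpos (one_le_bracket _) (by linarith)

end NormLe

/-! ### The Newton step. -/

/-- The hopping operator with the hops of length more than `3 ^ n` removed. -/
noncomputable def hopCut (φ : Lat d → ℝ) (n : ℕ) : Op d :=
  ofDiags (latBall d (3 ^ n)) fun k _ => (φ k : ℂ)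

/-- The residual `(T + V) Q + [D, Q]` of the conjugation equation `(T + V + D) Q = Q D`. -/
noncomputable def resid (p : Lat d → ℂ) (T Q : Op d) (v : Lat d → ℂ) : Op d :=
  (T + diagOp v) * Q + diagOp p * Q - Q * diagOp p

/-- The solution `W` of `[D, W] = -F` off the diagonal, for `F` with entries at distance at
most `N` from the diagonal. -/
noncomputable def commSol (p : Lat d → ℂ) (N : ℝ) (F : Op d) : Op d :=
  ofDiags ((latBall d N).erase 0) fun k i => -((p i - p (i - k))⁻¹ * entry F i (i - k))

/-- The `(i, j)` entry of `[D, W]` is `(p i - p j) W_{ij}`, so the equation is solved by division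
off the diagonal. The cutoff in `commSol` loses nothing for a banded `F`. -/
theorem commSol_spec {p : Lat d → ℂ} (hp : ∀ k : Lat d, k ≠ 0 → ∀ i, p i - shift k p i ≠ 0)
    {N : ℝ} {F : Op d} (hF : Band F N) :
    diagOp p * commSol p N F - commSol p N F * diagOp p = -(F - diagOp (kDiag (entry F) 0)) := by
  classical
  apply Op.ext_entry
  intro i j
  simp only [entry_sub, entry_neg, Matrix.sub_apply, Matrix.neg_apply, entry_diagOp_mul,
    entry_mul_diagOp, entry_diagOp, commSol, entry_ofDiags, Finset.mem_erase, mem_latBall]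
  by_cases hij : i = j
  · subst hij; simp [kDiag]
  · have hne : i - j ≠ 0 := sub_ne_zero.2 hij
    rw [if_neg hij]
    by_cases hN : ‖i - j‖ ≤ N
    · rw [if_pos ⟨hne, hN⟩, sub_sub_cancel]
      have h := hp _ hne i
      rw [shift, sub_sub_cancel] at h
      field_simp
      ring
    · rw [if_neg fun h => hN h.2, hF i j (not_le.1 hN)]
      ring

/-- With `F` the old residual and `G = diag g`, `(T + V) Q + D Q = F + Q D` turns the new residual
into `F + F W + Q [D, W]`, minus `G (Q + Q W)`, plus the hop increment. Since `Q [D, W] = -Q (F -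
G)`, the terms linear in `F` combine to `-(Q - 1) (F - G) + G`, and this `G` is absorbed by the
counterterm. -/
theorem resid_step {p v : Lat d → ℂ} {T T' Q W : Op d} {g : Lat d → ℂ}
    (hW : diagOp p * W - W * diagOp p = -(resid p T Q v - diagOp g)) :
    resid p T' (Q + Q * W) (v - g) =
      -(diagOp g * (Q - 1)) - (Q - 1) * (resid p T Q v - diagOp g) + resid p T Q v * W -
        diagOp g * (Q * W) + (T' - T) * (Q + Q * W) := by
  rw [← sub_eq_zero]
  have : Q * (diagOp p * W - W * diagOp p + (resid p T Q v - diagOp g)) = 0 := by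
    rw [hW, neg_add_cancel, mul_zero]
  rw [← this]
  simp only [resid, diagOp_sub]
  noncomm_ring

/-- The Newton iteration: approximate conjugations and approximate counterterms. -/
noncomputable def newton (p : Lat d → ℂ) (φ : Lat d → ℝ) : ℕ → Op d × (Lat d → ℂ)
  | 0 => (1, 0)
  | n + 1 =>
    let Q := (newton p φ n).1
    let v := (newton p φ n).2
    let F := resid p (hopCut φ n) Q v
    (Q + Q * commSol p (2 * 3 ^ n) F, v - kDiag (entry F) 0)

/-! ### Convergence of the Newton iteration. -/

/-- The data of the conjugation problem, with the smallness condition. -/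
structure NewtonData (d : ℕ) where
  B : TransInvBanachAlgebra d
  p : Lat d → ℂ
  φ : Lat d → ℝ
  (t τ σ γ ε : ℝ)
  ht : (d : ℝ) / 2 < t
  hτ : 0 < τ
  hσ : 0 < σ
  hγ : 0 < γ
  hε : 0 ≤ ε
  hφ : φ 0 = 0
  hp : p ∈ B.distal τ γ
  hT : B.sobNorm (hopping φ) (t + τ + σ) ≤ ENNReal.ofReal ε
  small : (algConst d t).toReal *
    (2 * (γ⁻¹ * 2 ^ τ * (4 * ε / (3 : ℝ) ^ (-(τ + σ)))) / (1 - (3 : ℝ) ^ (-σ))) ≤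
      (3 : ℝ) ^ (-(τ + σ)) / 16

namespace NewtonData
variable (S : NewtonData d)

/-- The constant of the algebra property. -/
noncomputable def K : ℝ := (algConst d S.t).toReal
/-- The ratio of convergence of the residuals. -/
noncomputable def ρ : ℝ := (3 : ℝ) ^ (-(S.τ + S.σ))
/-- The ratio of convergence of the conjugations. -/
noncomputable def q : ℝ := (3 : ℝ) ^ (-S.σ)
/-- The size of the first residual. -/
noncomputable def f : ℝ := 4 * S.ε / S.ρ
/-- The size of the first correction. -/
noncomputable def ω : ℝ := S.γ⁻¹ * 2 ^ S.τ * S.f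
/-- The size of `Q - 1`. -/
noncomputable def c : ℝ := 2 * S.ω / (1 - S.q)
/-- The approximate conjugations. -/
noncomputable def Q (n : ℕ) : Op d := (newton S.p S.φ n).1
/-- The approximate counterterms. -/
noncomputable def v (n : ℕ) : Lat d → ℂ := (newton S.p S.φ n).2
/-- The residuals. -/
noncomputable def F (n : ℕ) : Op d := resid S.p (hopCut S.φ n) (S.Q n) (S.v n)
/-- The corrections. -/
noncomputable def W (n : ℕ) : Op d := commSol S.p (2 * 3 ^ n) (S.F n)

theorem Q_zero : S.Q 0 = 1 := rfl
theorem v_zero : S.v 0 = 0 := rfl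
theorem Q_succ (n : ℕ) : S.Q (n + 1) = S.Q n + S.Q n * S.W n := rfl
theorem v_succ (n : ℕ) : S.v (n + 1) = S.v n - kDiag (entry (S.F n)) 0 := rfl

theorem K_nonneg : 0 ≤ S.K := ENNReal.toReal_nonneg
theorem ρ_pos : 0 < S.ρ := Real.rpow_pos_of_pos (by norm_num) _
theorem q_pos : 0 < S.q := Real.rpow_pos_of_pos (by norm_num) _
theorem ρ_lt_one : S.ρ < 1 :=
  Real.rpow_lt_one_of_one_lt_of_neg (by norm_num) (by linarith [S.hτ, S.hσ])
theorem q_lt_one : S.q < 1 := Real.rpow_lt_one_of_one_lt_of_neg (by norm_num) (by linarith [S.hσ])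
theorem f_nonneg : 0 ≤ S.f := div_nonneg (mul_nonneg (by norm_num) S.hε) S.ρ_pos.le
theorem ω_nonneg : 0 ≤ S.ω :=
  mul_nonneg (mul_nonneg (inv_nonneg.2 S.hγ.le) (by positivity)) S.f_nonneg
theorem c_nonneg : 0 ≤ S.c :=
  div_nonneg (mul_nonneg (by norm_num) S.ω_nonneg) (by linarith [S.q_lt_one])
theorem c_mul : S.c * (1 - S.q) = 2 * S.ω :=
  div_mul_cancel₀ _ (by linarith [S.q_lt_one])
theorem two_ω_le : 2 * S.ω ≤ S.c := by
  rw [← S.c_mul]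
  exact mul_le_of_le_one_right S.c_nonneg (by linarith [S.q_pos])
-- The `16` leaves a margin: `4 K c ≤ ρ / 4` makes the quadratic terms at most a quarter of the next
-- residual bound `f * ρ ^ (n + 1)`, and `ε = f ρ / 4` gives the hop increment another quarter.
theorem K_c_le : S.K * S.c ≤ S.ρ / 16 := S.small

theorem three_pow_mul_ρ (n : ℕ) : ((3 : ℝ) ^ n) ^ (S.τ + S.σ) * S.ρ ^ n = 1 := by
  rw [ρ, ← Real.rpow_natCast 3, ← Real.rpow_natCast _ n, ← Real.rpow_mul (by norm_num),
    ← Real.rpow_mul (by norm_num), ← Real.rpow_add (by norm_num)]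
  rw [show (n : ℝ) * (S.τ + S.σ) + -(S.τ + S.σ) * n = 0 by ring, Real.rpow_zero]

theorem three_pow_mul_ρ' (n : ℕ) : ((3 : ℝ) ^ n) ^ S.τ * S.ρ ^ n = S.q ^ n := by
  rw [ρ, q, ← Real.rpow_natCast 3, ← Real.rpow_natCast _ n, ← Real.rpow_natCast _ n,
    ← Real.rpow_mul (by norm_num), ← Real.rpow_mul (by norm_num), ← Real.rpow_mul (by norm_num),
    ← Real.rpow_add (by norm_num)]
  congr 1
  ring

theorem extNorm_hopping (k : Lat d) :
    S.B.extNorm (kDiag (hopping S.φ) k) = ENNReal.ofReal ‖(S.φ k : ℂ)‖ := by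
  rw [← S.B.extNorm_const]
  congr 1
  funext i
  simp [kDiag, hopping]

theorem normLe_hopCut_zero : NormLe S.B S.t (hopCut S.φ 0) S.ε := by
  classical
  rw [← one_mul S.ε]
  refine NormLe.of_extNorm_le zero_le_one S.hε S.hT fun k => ?_
  rw [hopCut, kDiag_ofDiags, ENNReal.ofReal_one, one_mul, extNorm_hopping]
  split_ifs
  · rw [S.B.extNorm_const]
    gcongr
    refine ENNReal.ofReal_le_ofReal (Real.rpow_le_rpow_of_exponent_le (one_le_bracket k) ?_)
    linarith [S.hτ, S.hσ]
  · simp [S.B.extNorm_zero]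

/-- Only hops longer than `3 ^ n` survive, so giving up `τ + σ` powers of the weight gains the
factor `ρ ^ n`. -/
theorem normLe_hopCut_sub (n : ℕ) :
    NormLe S.B S.t (hopCut S.φ (n + 1) - hopCut S.φ n) (S.ρ ^ n * S.ε) := by
  classical
  refine NormLe.of_extNorm_le (pow_nonneg S.ρ_pos.le n) S.hε S.hT fun k => ?_
  have h : kDiag (entry (hopCut S.φ (n + 1) - hopCut S.φ n)) k =
      kDiag (entry (hopCut S.φ (n + 1))) k - kDiag (entry (hopCut S.φ n)) k := rfl
  rw [h, hopCut, hopCut, kDiag_ofDiags, kDiag_ofDiags, extNorm_hopping]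
  simp only [mem_latBall]
  by_cases h1 : ‖k‖ ≤ 3 ^ n
  · have h2 : ‖k‖ ≤ 3 ^ (n + 1) := h1.trans (pow_le_pow_right₀ (by norm_num) n.le_succ)
    rw [if_pos h1, if_pos h2, sub_self, S.B.extNorm_zero]
    simp
  · rw [if_neg h1, sub_zero]
    split_ifs
    · rw [S.B.extNorm_const, mul_left_comm]
      gcongr
      rw [wt, wt, ← ENNReal.ofReal_mul (pow_nonneg S.ρ_pos.le n)]
      apply ENNReal.ofReal_le_ofReal
      have hb : (3 : ℝ) ^ n ≤ bracket k := (not_le.1 h1).le.trans (norm_le_bracket k)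
      have h3 : 1 ≤ bracket k ^ (S.τ + S.σ) * S.ρ ^ n := by
        rw [← S.three_pow_mul_ρ n]
        have := S.ρ_pos
        have := S.hτ
        have := S.hσ
        gcongr
      rw [add_assoc, Real.rpow_add (bracket_pos k)]
      have h4 := Real.rpow_nonneg (bracket_pos k).le S.t
      nlinarith
    · simp [S.B.extNorm_zero]

theorem band_hopCut (φ : Lat d → ℝ) (n : ℕ) : Band (hopCut φ n) (3 ^ n) :=
  band_ofDiags (fun _ hk => mem_latBall.1 hk) _

theorem kDiag_hopCut_zero (n : ℕ) : kDiag (entry (hopCut S.φ n)) 0 = 0 := by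
  classical
  rw [hopCut, kDiag_ofDiags, S.hφ]
  split_ifs
  · simp; rfl
  · rfl

theorem band_one {N : ℝ} (hN : 0 ≤ N) : Band (1 : Op d) N := by
  rw [← diagOp_one]
  exact band_diagOp _ hN

theorem band_F_of_band_Q {n : ℕ} (h : Band (S.Q n) (3 ^ n)) : Band (S.F n) (2 * 3 ^ n) := by
  have h3 : (0 : ℝ) ≤ 3 ^ n := by positivity
  have h1 := ((band_hopCut S.φ n).add (band_diagOp (S.v n) h3)).mul h
  have h2 := ((band_diagOp S.p h3).mul h)
  have h4 := (h.mul (band_diagOp S.p h3))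
  rw [two_mul]
  exact (h1.add h2).sub h4

theorem band_W (n : ℕ) : Band (S.W n) (2 * 3 ^ n) := by
  rw [W, commSol]
  refine band_ofDiags (fun k hk => ?_) _
  exact mem_latBall.1 (Finset.mem_of_mem_erase hk)

/-- The base `3` of the scales comes from here: multiplying by `W` adds the width `2 * 3 ^ n` of the
residual to `3 ^ n`. -/
theorem band_Q (n : ℕ) : Band (S.Q n) (3 ^ n) := by
  induction n with
  | zero => exact band_one (by norm_num)
  | succ n ih =>
    have h3 : (0 : ℝ) ≤ 3 ^ n := by positivity
    have h := ih.mul (S.band_W n)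
    rw [show (3 : ℝ) ^ n + 2 * 3 ^ n = 3 ^ (n + 1) by ring] at h
    exact (ih.mono (by rw [pow_succ]; linarith)).add h

theorem band_F (n : ℕ) : Band (S.F n) (2 * 3 ^ n) := S.band_F_of_band_Q (S.band_Q n)

theorem comm_W (n : ℕ) : diagOp S.p * S.W n - S.W n * diagOp S.p =
    -(S.F n - diagOp (kDiag (entry (S.F n)) 0)) :=
  commSol_spec (fun k hk => (S.hp k hk).1) (S.band_F n)

/-- On diagonals with `‖k‖ ≤ 2 * 3 ^ n` the inverse divisors have norm at most `γ⁻¹ (2 * 3 ^ n) ^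
τ`, and `(3 ^ n) ^ τ * ρ ^ n = q ^ n`. The decay of the residual pays for the small divisors. -/
theorem normLe_W {n : ℕ} (h : NormLe S.B S.t (S.F n) (S.f * S.ρ ^ n)) :
    NormLe S.B S.t (S.W n) (S.ω * S.q ^ n) := by
  classical
  have hn : (0 : ℝ) ≤ 2 * 3 ^ n := by positivity
  have hc : 0 ≤ S.γ⁻¹ * (2 * 3 ^ n : ℝ) ^ S.τ :=
    mul_nonneg (inv_nonneg.2 S.hγ.le) (Real.rpow_nonneg hn _)
  have h1 : NormLe S.B S.t (S.W n) (S.γ⁻¹ * (2 * 3 ^ n : ℝ) ^ S.τ * (S.f * S.ρ ^ n)) := by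
    refine NormLe.of_extNorm_le hc h.1 h.2 fun k => ?_
    rw [← mul_assoc]
    gcongr
    rw [W, commSol, kDiag_ofDiags]
    split_ifs with hk
    · rw [Finset.mem_erase, mem_latBall] at hk
      obtain ⟨-, hmem, hle⟩ := S.hp k hk.1
      have h2 := S.B.extNorm_mul_le (fun i => (S.p i - shift k S.p i)⁻¹) (kDiag (entry (S.F n)) k)
      rw [← S.B.extNorm_neg] at h2
      refine h2.trans ?_
      gcongr
      rw [S.B.extNorm_of_mem hmem]
      refine ENNReal.ofReal_le_ofReal (hle.trans ?_)
      have := S.hγ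
      have := S.hτ
      gcongr
      exact hk.2
    · simp [S.B.extNorm_zero]
  convert h1 using 1
  rw [Real.mul_rpow (by norm_num) (by positivity), ← S.three_pow_mul_ρ' n, ω]
  ring

theorem normLe_QW {n : ℕ} (hQ : NormLe S.B S.t (S.Q n - 1) S.c)
    (hW : NormLe S.B S.t (S.W n) (S.ω * S.q ^ n)) :
    NormLe S.B S.t (S.Q n * S.W n) (2 * S.ω * S.q ^ n) := by
  have hb : Band (S.Q n - 1) (3 ^ n) := (S.band_Q n).sub (band_one (by positivity))
  have h := hW.add (NormLe.mul S.ht hb hQ hW)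
  rw [show S.W n + (S.Q n - 1) * S.W n = S.Q n * S.W n by noncomm_ring] at h
  refine h.mono ?_
  have h1 : S.K * S.c ≤ 1 := S.K_c_le.trans (by linarith [S.ρ_lt_one])
  have h2 := mul_le_mul_of_nonneg_right h1 hW.1
  change S.ω * S.q ^ n + S.K * (S.c * (S.ω * S.q ^ n)) ≤ _
  linarith

theorem F_succ (n : ℕ) : S.F (n + 1) =
    -(diagOp (kDiag (entry (S.F n)) 0) * (S.Q n - 1)) -
      (S.Q n - 1) * (S.F n - diagOp (kDiag (entry (S.F n)) 0)) + S.F n * S.W n -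
      diagOp (kDiag (entry (S.F n)) 0) * (S.Q n * S.W n) +
      (hopCut S.φ (n + 1) - hopCut S.φ n) * S.Q (n + 1) :=
  resid_step (S.comm_W n)

/-- The hop increment, the only first-order part of the new residual, is subtracted. The remaining
bound, with its extra factor `c`, closes the induction and also measures the diagonal. -/
theorem normLe_F_succ_sub {n : ℕ} (hQ : NormLe S.B S.t (S.Q n - 1) S.c)
    (hQ' : NormLe S.B S.t (S.Q (n + 1) - 1) S.c)
    (hF : NormLe S.B S.t (S.F n) (S.f * S.ρ ^ n)) :
    NormLe S.B S.t (S.F (n + 1) - (hopCut S.φ (n + 1) - hopCut S.φ n))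
      (4 * S.K * S.c * (S.f * S.ρ ^ n)) := by
  have hW := S.normLe_W hF
  have hQW := S.normLe_QW hQ hW
  have hb : Band (S.Q n - 1) (3 ^ n) := (S.band_Q n).sub (band_one (by positivity))
  have hbG := band_diagOp (kDiag (entry (S.F n)) 0) le_rfl
  have hbT : Band (hopCut S.φ (n + 1) - hopCut S.φ n) (3 ^ (n + 1)) :=
    (band_hopCut _ _).sub ((band_hopCut _ _).mono (pow_le_pow_right₀ (by norm_num) n.le_succ))
  have h1 := (NormLe.mul S.ht hbG hF.diagPart hQ).neg
  have h2 := NormLe.mul S.ht hb hQ hF.offDiag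
  have h3 := NormLe.mul S.ht (S.band_F n) hF hW
  have h4 := NormLe.mul S.ht hbG hF.diagPart hQW
  have h5 := NormLe.mul S.ht hbT (S.normLe_hopCut_sub n) hQ'
  have h := (((h1.sub h2).add h3).sub h4).add h5
  have e : S.F (n + 1) - (hopCut S.φ (n + 1) - hopCut S.φ n) =
      -(diagOp (kDiag (entry (S.F n)) 0) * (S.Q n - 1)) -
      (S.Q n - 1) * (S.F n - diagOp (kDiag (entry (S.F n)) 0)) + S.F n * S.W n -
      diagOp (kDiag (entry (S.F n)) 0) * (S.Q n * S.W n) +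
      (hopCut S.φ (n + 1) - hopCut S.φ n) * (S.Q (n + 1) - 1) := by
    rw [S.F_succ n, mul_sub _ (S.Q (n + 1)), mul_one, add_sub_assoc]
  rw [e]
  refine h.mono ?_
  have hw : S.ω * S.q ^ n ≤ S.c / 2 := by
    have := mul_le_of_le_one_right S.ω_nonneg (pow_le_one₀ (n := n) S.q_pos.le S.q_lt_one.le)
    linarith [S.two_ω_le]
  have hε : S.ρ ^ n * S.ε ≤ S.f * S.ρ ^ n / 4 := by
    have : S.ε = S.f * S.ρ / 4 := by
      rw [f]; field_simp [S.ρ_pos.ne']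
    rw [this]
    have := mul_le_of_le_one_right hF.1 S.ρ_lt_one.le
    linarith
  have e1 := mul_le_mul_of_nonneg_left hw hF.1
  have e2 := mul_le_mul_of_nonneg_right hε S.c_nonneg
  -- In units of `K c f ρ ^ n` the five terms are at most `1`, `1`, `1/2`, `1` and `1/4`, which
  -- total less than `4`.
  change S.K * (S.f * S.ρ ^ n * S.c) + S.K * (S.c * (S.f * S.ρ ^ n)) +
    S.K * (S.f * S.ρ ^ n * (S.ω * S.q ^ n)) + S.K * (S.f * S.ρ ^ n * (2 * S.ω * S.q ^ n)) +
    S.K * (S.ρ ^ n * S.ε * S.c) ≤ _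
  have e3 := mul_le_mul_of_nonneg_left (add_le_add (add_le_add e1 e1) (add_le_add e1 e2)) S.K_nonneg
  have e4 := mul_nonneg S.K_nonneg (mul_nonneg hF.1 S.c_nonneg)
  linarith

theorem F_zero : S.F 0 = hopCut S.φ 0 := by
  rw [F, resid, Q_zero, v_zero, diagOp_zero]
  noncomm_ring

/-- The two bounds feed each other. `c * (1 - q ^ n)` is the partial sum of the increments `2 ω q ^
m`, so `Q - 1` never exceeds `c`, and this keeps the quadratic terms of the residual under control.
-/
theorem normLe_Q_F (n : ℕ) : NormLe S.B S.t (S.Q n - 1) (S.c * (1 - S.q ^ n)) ∧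
    NormLe S.B S.t (S.F n) (S.f * S.ρ ^ n) := by
  have hle : ∀ n, S.c * (1 - S.q ^ n) ≤ S.c := fun n =>
    mul_le_of_le_one_right S.c_nonneg (by linarith [pow_pos S.q_pos n])
  induction n with
  | zero =>
    constructor
    · rw [Q_zero, sub_self]
      simpa using NormLe.zero
    · rw [F_zero]
      refine S.normLe_hopCut_zero.mono ?_
      rw [pow_zero, mul_one, f, le_div_iff₀ S.ρ_pos]
      nlinarith [S.hε, S.ρ_lt_one]
  | succ n ih =>
    have hQ := ih.1.mono (hle n)
    have hW := S.normLe_W ih.2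
    have hQ' : NormLe S.B S.t (S.Q (n + 1) - 1) (S.c * (1 - S.q ^ (n + 1))) := by
      have h := ih.1.add (S.normLe_QW hQ hW)
      rw [show S.Q n - 1 + S.Q n * S.W n = S.Q (n + 1) - 1 by rw [Q_succ]; abel] at h
      refine h.mono (le_of_eq ?_)
      rw [← S.c_mul]
      ring
    refine ⟨hQ', ?_⟩
    have h := (S.normLe_F_succ_sub hQ (hQ'.mono (hle _)) ih.2).add (S.normLe_hopCut_sub n)
    rw [sub_add_cancel] at h
    refine h.mono ?_
    have hε : S.ε = S.f * S.ρ / 4 := by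
      rw [f]; field_simp [S.ρ_pos.ne']
    have h1 := mul_le_mul_of_nonneg_right S.K_c_le ih.2.1
    rw [hε, pow_succ]
    have h2 := mul_nonneg ih.2.1 S.ρ_pos.le
    linarith

theorem normLe_Q (n : ℕ) : NormLe S.B S.t (S.Q n - 1) S.c :=
  (S.normLe_Q_F n).1.mono
    (mul_le_of_le_one_right S.c_nonneg (by linarith [pow_pos S.q_pos n]))

theorem normLe_F (n : ℕ) : NormLe S.B S.t (S.F n) (S.f * S.ρ ^ n) := (S.normLe_Q_F n).2

theorem normLe_Q_succ_sub (n : ℕ) :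
    NormLe S.B S.t (S.Q (n + 1) - S.Q n) (2 * S.ω * S.q ^ n) := by
  rw [Q_succ, add_sub_cancel_left]
  exact S.normLe_QW (S.normLe_Q n) (S.normLe_W (S.normLe_F n))

/-- The diagonal parts of the residuals are of second order. -/
theorem extNorm_diag_F_le (n : ℕ) : S.B.extNorm (kDiag (entry (S.F n)) 0) ≤
    ENNReal.ofReal (4 * S.K * S.c * S.f / S.ρ * S.ρ ^ n) := by
  cases n with
  | zero =>
    rw [F_zero, kDiag_hopCut_zero, S.B.extNorm_zero]
    simp
  | succ n =>
    have h := (S.normLe_F_succ_sub (S.normLe_Q n) (S.normLe_Q (n + 1))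
      (S.normLe_F n)).extNorm_kDiag_zero_le
    have e : kDiag (entry (S.F (n + 1) - (hopCut S.φ (n + 1) - hopCut S.φ n))) 0 =
        kDiag (entry (S.F (n + 1))) 0 -
          (kDiag (entry (hopCut S.φ (n + 1))) 0 - kDiag (entry (hopCut S.φ n)) 0) := rfl
    -- `φ 0 = 0` removes the hop increment from the diagonal, so only the second-order part is left.
    rw [e, kDiag_hopCut_zero, kDiag_hopCut_zero, sub_zero, sub_zero] at h
    refine h.trans (le_of_eq ?_)
    congr 1
    rw [pow_succ]
    field_simp [S.ρ_pos.ne']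

end NewtonData

/-! ### From column-finite matrices to bounded operators on `ℓ²`. -/

theorem ell2_norm_sq (u : ell2 d) : HasSum (fun i => ‖u i‖ ^ 2) (‖u‖ ^ 2) := by
  have h := lp.hasSum_norm (p := 2) (by norm_num) u
  simpa using h

theorem ell2_norm_le {u w : ell2 d} {c : ℝ} (hc : 0 ≤ c) (e : Lat d ≃ Lat d)
    (h : ∀ i, ‖u i‖ ≤ c * ‖w (e i)‖) : ‖u‖ ≤ c * ‖w‖ := by
  refine le_of_sq_le_sq ?_ (mul_nonneg hc (norm_nonneg _))
  have h1 := (e.hasSum_iff.2 (ell2_norm_sq w)).mul_left (c ^ 2)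
  rw [mul_pow]
  refine hasSum_le (fun i => ?_) (ell2_norm_sq u) h1
  simp only [Function.comp]
  rw [← mul_pow]
  exact pow_le_pow_left₀ (norm_nonneg _) (h i) 2

/-- The inclusion of the finitely supported sequences in `ℓ²`. -/
noncomputable def incl (d : ℕ) : (Lat d →₀ ℂ) →ₗ[ℂ] ell2 d where
  toFun f := ⟨(f : Lat d → ℂ), memℓp_gen (summable_of_ne_finset_zero (s := f.support) fun i hi => by
    rw [Finsupp.notMem_support_iff.1 hi]; simp)⟩
  map_add' f g := rfl
  map_smul' c f := rfl

@[simp] theorem incl_apply (f : Lat d →₀ ℂ) (i : Lat d) : incl d f i = f i := rfl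

/-- The standard basis vectors of `ℓ²`. -/
noncomputable def basisVec (j : Lat d) : ell2 d := incl d (Finsupp.single j 1)

theorem basisVec_apply (j i : Lat d) : basisVec j i = if i = j then 1 else 0 := by
  simp [basisVec, Finsupp.single_apply, eq_comm]

theorem hasSum_basisVec (u : ell2 d) : HasSum (fun j => u j • basisVec j) u := by
  have h := lp.hasSum_single (p := 2) (by norm_num) u
  convert h using 2 with j
  apply lp.ext
  funext i
  by_cases hij : i = j
  · subst hij
    simp [basisVec_apply]
  · simp [basisVec_apply, hij]

theorem span_basisVec_dense :
    (Submodule.span ℂ (Set.range (basisVec (d := d)))).topologicalClosure = ⊤ := by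
  rw [eq_top_iff]
  intro u _
  refine mem_closure_of_tendsto (hasSum_basisVec u) (Eventually.of_forall fun s => ?_)
  exact Submodule.sum_mem _ fun j _ => Submodule.smul_mem _ _ (Submodule.subset_span ⟨j, rfl⟩)

theorem denseRange_incl : DenseRange (incl d) := by
  intro u
  refine mem_closure_of_tendsto (hasSum_basisVec u) (Eventually.of_forall fun s => ?_)
  refine ⟨∑ j ∈ s, u j • Finsupp.single j 1, ?_⟩
  simp only [map_sum, map_smul, basisVec]

/-- The coordinates of `ℓ²`, as continuous linear functionals. -/
noncomputable def coord (i : Lat d) : ell2 d →L[ℂ] ℂ :=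
  LinearMap.mkContinuous
    { toFun := fun u => u i
      map_add' := fun _ _ => rfl
      map_smul' := fun _ _ => rfl } 1
    fun u => (lp.norm_apply_le_norm (by norm_num) u i).trans_eq (one_mul _).symm

@[simp] theorem coord_apply (i : Lat d) (u : ell2 d) : coord i u = u i := rfl

theorem hasSum_clm_apply (L : ell2 d →L[ℂ] ell2 d) (u : ell2 d) (i : Lat d) :
    HasSum (fun j => u j * L (basisVec j) i) (L u i) := by
  have h := ((hasSum_basisVec u).mapL L).mapL (coord i)
  simpa using h

theorem tendsto_apply {L : ℕ → ell2 d →L[ℂ] ell2 d} {L' : ell2 d →L[ℂ] ell2 d}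
    (h : Tendsto L atTop (𝓝 L')) (u : ell2 d) (i : Lat d) :
    Tendsto (fun n => L n u i) atTop (𝓝 (L' u i)) := by
  have h1 : Tendsto (fun n => L n u) atTop (𝓝 (L' u)) :=
    ((ContinuousLinearMap.apply ℂ (ell2 d) u).continuous.tendsto L').comp h
  exact ((coord i).continuous.tendsto _).comp h1

/-- The bounded operator `L` extends the operator `A` on finitely supported sequences. -/
def Extends (L : ell2 d →L[ℂ] ell2 d) (A : Op d) : Prop := ∀ f, L (incl d f) = incl d (A f)

theorem Extends.add {L L' : ell2 d →L[ℂ] ell2 d} {A A' : Op d} (h : Extends L A)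
    (h' : Extends L' A') : Extends (L + L') (A + A') := fun f => by
  rw [add_apply, h, h']; rfl

theorem Extends.mul {L L' : ell2 d →L[ℂ] ell2 d} {A A' : Op d} (h : Extends L A)
    (h' : Extends L' A') : Extends (L * L') (A * A') := fun f => by
  rw [mul_apply_eq_comp, h', h]; rfl

theorem Extends.one : Extends (1 : ell2 d →L[ℂ] ell2 d) 1 := fun _ => rfl

theorem Extends.apply {L : ell2 d →L[ℂ] ell2 d} {A : Op d} (h : Extends L A) (i j : Lat d) :
    L (basisVec j) i = entry A i j := by
  rw [basisVec, h]; rfl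

/-- The norm of the embedding of the Sobolev algebra in the bounded operators. -/
noncomputable def embConst (d : ℕ) (t : ℝ) : ℝ := (wtSum d t ^ (1 / 2 : ℝ)).toReal

/-- The operator is a finite sum of translations followed by multiplication by its diagonals, so its
norm is at most the sum of their sup norms. Cauchy–Schwarz bounds that sum by the Sobolev norm, and
density of finitely supported sequences gives the extension. -/
theorem exists_extends {B : TransInvBanachAlgebra d} {t a N : ℝ} (ht : (d : ℝ) / 2 < t) {A : Op d}
    (hN : Band A N) (hA : NormLe B t A a) :
    ∃ L : ell2 d →L[ℂ] ell2 d, Extends L A ∧ ‖L‖ ≤ embConst d t * a := by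
  let x : Lat d → ℝ := fun k => (B.extNorm (kDiag (entry A) k)).toReal
  have hfin : ∀ k, B.extNorm (kDiag (entry A) k) ≠ ∞ := fun k hk => by
    have h := hA.extNorm_kDiag_le k
    rw [hk, ENNReal.top_mul (wt_ne_zero t k)] at h
    exact ENNReal.ofReal_ne_top (top_le_iff.1 h)
  have hx : ∀ k i, ‖kDiag (entry A) k i‖ ≤ x k := fun k i =>
    (ENNReal.ofReal_le_iff_le_toReal (hfin k)).1 (B.norm_apply_le_extNorm _ i)
  have hsum : ∑ k ∈ latBall d N, x k ≤ embConst d t * a := by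
    have hw : wtSum d t ^ (1 / 2 : ℝ) ≠ ∞ :=
      ENNReal.rpow_ne_top_of_nonneg (by norm_num) (wtSum_ne_top ht)
    rw [← ENNReal.toReal_sum fun k _ => hfin k, embConst, ← ENNReal.toReal_ofReal hA.1,
      ← ENNReal.toReal_mul]
    refine ENNReal.toReal_mono (ENNReal.mul_ne_top hw ENNReal.ofReal_ne_top) ?_
    refine (ENNReal.sum_le_tsum _).trans ((tsum_le_l2_wt (t := t) _).trans ?_)
    rw [← B.sobNorm_eq_l2]
    gcongr
    exact hA.2
  have hbd : ∀ f, ‖incl d (A f)‖ ≤ embConst d t * a * ‖incl d f‖ := by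
    intro f
    let g : Lat d → (Lat d →₀ ℂ) := fun k => ofDiags {k} (kDiag (entry A)) f
    have hg : ∀ k i, g k i = kDiag (entry A) k i * f (i - k) := by
      intro k i
      refine (hasSum_apply _ f i).unique ?_
      convert hasSum_single (i - k) (fun m hm => ?_) using 1
      · rw [entry_ofDiags]; simp
      · rw [entry_ofDiags, if_neg, zero_mul]
        rw [Finset.mem_singleton]
        rintro rfl
        simp at hm
    have he : A f = ∑ k ∈ latBall d N, g k := by
      ext i
      rw [Finsupp.finsetSum_apply]
      have h1 := hasSum_apply A f i
      rw [← (Equiv.subLeft i).hasSum_iff] at h1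
      refine h1.unique ?_
      have h2 : ∀ l ∉ latBall d N, ((fun m => entry A i m * f m) ∘ Equiv.subLeft i) l = 0 := by
        intro l hl
        have : entry A i (i - l) = 0 := hN _ _ (by simpa [mem_latBall] using hl)
        simp [this]
      convert hasSum_sum_of_ne_finset_zero (L := .unconditional _) h2 using 2 with l
      simp [hg, kDiag]
    rw [he, map_sum]
    calc _ ≤ ∑ k ∈ latBall d N, ‖incl d (g k)‖ := norm_sum_le _ _
      _ ≤ ∑ k ∈ latBall d N, x k * ‖incl d f‖ := by
          refine Finset.sum_le_sum fun k _ => ?_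
          refine ell2_norm_le ENNReal.toReal_nonneg (Equiv.subRight k) fun i => ?_
          simp only [incl_apply, hg, norm_mul, Equiv.subRight_apply]
          gcongr
          exact hx k i
      _ = (∑ k ∈ latBall d N, x k) * ‖incl d f‖ := by rw [Finset.sum_mul]
      _ ≤ _ := by gcongr
  let A₀ : (Lat d →₀ ℂ) →ₗ[ℂ] ell2 d := incl d ∘ₗ (A : Module.End ℂ (Lat d →₀ ℂ))
  refine ⟨A₀.extendOfNorm (incl d), fun f => ?_, ?_⟩
  · exact LinearMap.extendOfNorm_eq denseRange_incl ⟨_, hbd⟩ f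
  · exact ContinuousLinearMap.opNorm_le_bound _ (mul_nonneg ENNReal.toReal_nonneg hA.1)
      fun u => LinearMap.norm_extendOfNorm_apply_le denseRange_incl _ hbd u

/-- The extended increments form an absolutely convergent telescoping series in operator norm. -/
theorem exists_limit_extends {B : TransInvBanachAlgebra d} {t : ℝ} (ht : (d : ℝ) / 2 < t)
    {A : ℕ → Op d} {b : ℕ → ℝ} {L₀ : ell2 d →L[ℂ] ell2 d} (h0 : Extends L₀ (A 0))
    (hband : ∀ n, ∃ N, Band (A (n + 1) - A n) N) (hb : Summable b)
    (hA : ∀ n, NormLe B t (A (n + 1) - A n) (b n)) :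
    ∃ (L : ℕ → ell2 d →L[ℂ] ell2 d) (L' : ell2 d →L[ℂ] ell2 d), (∀ n, Extends (L n) (A n)) ∧
      Tendsto L atTop (𝓝 L') ∧ ‖L' - L₀‖ ≤ embConst d t * ∑' n, b n := by
  choose N hN using hband
  choose D hD hDn using fun n => exists_extends ht (hN n) (hA n)
  have hs : Summable fun n => embConst d t * b n := hb.mul_left _
  refine ⟨fun n => L₀ + ∑ m ∈ Finset.range n, D m, L₀ + ∑' m, D m, fun n => ?_, ?_, ?_⟩
  · induction n with
    | zero => simpa using h0
    | succ n ih =>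
      have h := ih.add (hD n)
      rwa [add_sub_cancel, add_assoc, ← Finset.sum_range_succ] at h
  · exact (Summable.of_norm_bounded hs hDn).hasSum.tendsto_sum_nat.const_add L₀
  · rw [add_sub_cancel_left, ← tsum_mul_left]
    exact tsum_of_norm_bounded hs.hasSum hDn

/-! ### The limit of the iteration. -/

namespace NewtonData
variable (S : NewtonData d)

theorem normLe_counterterm (n : ℕ) : NormLe S.B S.t
    (hopCut S.φ (n + 1) + diagOp (S.v (n + 1)) - (hopCut S.φ n + diagOp (S.v n)))
    ((S.ε + S.f) * S.ρ ^ n) := by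
  have h := (S.normLe_hopCut_sub n).sub (S.normLe_F n).diagPart
  rw [v_succ, diagOp_sub]
  convert h using 1
  · abel
  · ring

/-- `T + V` and `Q` converge in operator norm, but `D` may be unbounded, so the equation passes to
the limit entry by entry, where `D` acts by the scalars `p i` and `p j`. -/
theorem exists_conjugation (hsmall : embConst d S.t * S.c ≤ 1 / 2) :
    ∃ (v : Lat d → ℂ) (M Q : ell2 d →L[ℂ] ell2 d),
      S.B.extNorm v ≤ ENNReal.ofReal (4 * S.K * S.c * S.f / S.ρ / (1 - S.ρ)) ∧
      (∀ i j, M (basisVec j) i = (S.φ (i - j) : ℂ) + if i = j then v i else 0) ∧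
      (∀ i j, M (Q (basisVec j)) i + S.p i * Q (basisVec j) i = S.p j * Q (basisVec j) i) ∧
      ‖Q - 1‖ ≤ 1 / 2 ∧
      ∀ i j, ‖Q (basisVec j) i - if i = j then 1 else 0‖ ≤ S.c * bracket (i - j) ^ (-S.t) := by
  have hρ := summable_geometric_of_lt_one S.ρ_pos.le S.ρ_lt_one
  have hq := summable_geometric_of_lt_one S.q_pos.le S.q_lt_one
  set μ := 4 * S.K * S.c * S.f / S.ρ with hμ
  have hμ0 : 0 ≤ μ := by
    have := S.K_nonneg
    have := S.c_nonneg
    have := S.f_nonneg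
    have := S.ρ_pos
    positivity
  obtain ⟨v, hv, hvt⟩ := S.B.exists_limit (u := S.v) (hρ.mul_left μ)
    (fun n => mul_nonneg hμ0 (pow_nonneg S.ρ_pos.le n)) S.v_zero (fun n => by
      rw [v_succ, sub_sub_cancel_left, S.B.extNorm_neg]
      exact S.extNorm_diag_F_le n)
  rw [tsum_mul_left, tsum_geometric_of_lt_one S.ρ_pos.le S.ρ_lt_one, ← div_eq_mul_inv] at hv
  obtain ⟨L, Q, hL, hLQ, hQ⟩ := exists_limit_extends S.ht (A := S.Q) Extends.one
    (fun n => ⟨_, (S.band_Q (n + 1)).sub ((S.band_Q n).mono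
      (pow_le_pow_right₀ (by norm_num) n.le_succ))⟩) (hq.mul_left (2 * S.ω)) S.normLe_Q_succ_sub
  have hb : ∀ n, Band (hopCut S.φ n + diagOp (S.v n)) (3 ^ n) := fun n =>
    (band_hopCut _ n).add (band_diagOp _ (by positivity))
  have h00 : hopCut S.φ 0 + diagOp (S.v 0) = hopCut S.φ 0 := by
    rw [v_zero, diagOp_zero, add_zero]
  obtain ⟨M₀, hM₀, -⟩ := exists_extends S.ht (band_hopCut S.φ 0) S.normLe_hopCut_zero
  obtain ⟨M', M, hM', hMM, -⟩ := exists_limit_extends S.ht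
    (A := fun n => hopCut S.φ n + diagOp (S.v n)) (L₀ := M₀) (by rwa [h00])
    (fun n => ⟨_, (hb (n + 1)).sub ((hb n).mono
      (pow_le_pow_right₀ (by norm_num) n.le_succ))⟩) (hρ.mul_left (S.ε + S.f)) S.normLe_counterterm
  have hvi : ∀ i, Tendsto (fun n => S.v n i) atTop (𝓝 (v i)) := by
    intro i
    rw [tendsto_iff_norm_sub_tendsto_zero]
    have h1 := tendsto_of_tendsto_of_tendsto_of_le_of_le tendsto_const_nhds hvt
      (fun _ => zero_le) fun n => S.B.norm_apply_le_extNorm (S.v n - v) i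
    have h2 := (ENNReal.tendsto_toReal ENNReal.zero_ne_top).comp h1
    simpa [Function.comp_def, ENNReal.toReal_ofReal] using h2
  refine ⟨v, M, Q, hv, fun i j => ?_, fun i j => ?_, ?_, fun i j => ?_⟩
  · refine tendsto_nhds_unique (tendsto_apply hMM _ i) ?_
    have h1 : Tendsto (fun n => entry (hopCut S.φ n) i j) atTop (𝓝 (S.φ (i - j) : ℂ)) := by
      classical
      obtain ⟨n₀, hn₀⟩ := pow_unbounded_of_one_lt ‖i - j‖ (by norm_num : (1 : ℝ) < 3)
      refine tendsto_const_nhds.congr' ?_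
      filter_upwards [eventually_ge_atTop n₀] with n hn
      rw [hopCut, entry_ofDiags, if_pos]
      exact mem_latBall.2 (hn₀.le.trans (pow_le_pow_right₀ (by norm_num) hn))
    have h2 : Tendsto (fun n => entry (diagOp (S.v n)) i j) atTop
        (𝓝 (if i = j then v i else 0)) := by
      simp only [entry_diagOp]
      split_ifs
      exacts [hvi i, tendsto_const_nhds]
    refine (h1.add h2).congr fun n => ?_
    rw [(hM' n).apply]; rfl
  · have h1 : Tendsto (fun n => entry (S.F n) i j) atTop (𝓝 0) := by
      have ht0 : 0 ≤ S.t := (div_nonneg (Nat.cast_nonneg d) zero_le_two).trans S.ht.le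
      refine squeeze_zero_norm (fun n => (S.normLe_F n).norm_entry_le' ht0 i j) ?_
      simpa using (tendsto_pow_atTop_nhds_zero_of_lt_one S.ρ_pos.le S.ρ_lt_one).const_mul S.f
    have h2 : Tendsto (fun n => M' n * L n) atTop (𝓝 (M * Q)) := hMM.mul hLQ
    have h3 := ((tendsto_apply h2 (basisVec j) i).add
      ((tendsto_apply hLQ (basisVec j) i).const_mul (S.p i))).sub
      ((tendsto_apply hLQ (basisVec j) i).mul_const (S.p j))
    have h4 := tendsto_nhds_unique h1 (h3.congr fun n => ?_)
    · rw [eq_comm, sub_eq_zero] at h4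
      rw [mul_comm (S.p j)]
      exact h4
    · rw [((hM' n).mul (hL n)).apply, (hL n).apply, F, resid, entry_sub, entry_add,
        Matrix.sub_apply, Matrix.add_apply, entry_diagOp_mul, entry_mul_diagOp]
  · refine hQ.trans (le_trans (le_of_eq ?_) hsmall)
    rw [tsum_mul_left, tsum_geometric_of_lt_one S.q_pos.le S.q_lt_one, c, div_eq_mul_inv]
  · refine le_of_tendsto ((tendsto_apply hLQ (basisVec j) i).sub_const _).norm
      (Eventually.of_forall fun n => ?_)
    rw [(hL n).apply, ← entry_one]
    exact (S.normLe_Q n).norm_entry_le i j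

end NewtonData

/-! ### Bounded perturbations of a diagonal operator and their spectrum. -/

theorem exists_mulOp {g : Lat d → ℂ} {C : ℝ} (hC : 0 ≤ C) (hg : ∀ i, ‖g i‖ ≤ C) :
    ∃ G : ell2 d →L[ℂ] ell2 d, (∀ u i, G u i = g i * u i) ∧ ‖G‖ ≤ C := by
  have hmem : ∀ u : ell2 d, Memℓp (fun i => g i * u i) 2 := fun u =>
    (lp.memℓp ((C : ℂ) • u)).mono' fun i => by
      rw [lp.coeFn_smul, Pi.smul_apply, norm_mul, norm_smul, Complex.norm_real,
        Real.norm_of_nonneg hC]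
      gcongr
      exact hg i
  let G₀ : ell2 d →ₗ[ℂ] ell2 d :=
    { toFun := fun u => ⟨fun i => g i * u i, hmem u⟩
      map_add' := fun u w => lp.ext (funext fun i => mul_add (g i) (u i) (w i))
      map_smul' := fun a u => lp.ext (funext fun i => mul_left_comm (g i) a (u i)) }
  have hG : ∀ u, ‖G₀ u‖ ≤ C * ‖u‖ := fun u => ell2_norm_le hC (Equiv.refl _) fun i => by
    change ‖g i * u i‖ ≤ C * ‖u i‖
    rw [norm_mul]
    gcongr
    exact hg i
  exact ⟨G₀.mkContinuous C hG, fun u i => rfl, LinearMap.mkContinuous_norm_le _ hC _⟩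

theorem matAct_diagonal (a u : Lat d → ℂ) (i : Lat d) :
    HasSum (fun j => Matrix.diagonal a i j * u j) (a i * u i) := by
  convert hasSum_single i (fun m hm => ?_) using 1
  · rw [Matrix.diagonal_apply_eq]
  · rw [Matrix.diagonal_apply_ne' _ hm, zero_mul]

/-- `H` acts as `M + D` on the maximal domain of the diagonal operator `D = diag p`. -/
structure IsDiagPerturbation (H : ell2 d →ₗ.[ℂ] ell2 d) (p : Lat d → ℂ)
    (M : ell2 d →L[ℂ] ell2 d) : Prop where
  mem_domain_iff : ∀ u, u ∈ H.domain ↔ Memℓp (fun i => p i * u i) 2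
  apply : ∀ u (h : u ∈ H.domain) i, H ⟨u, h⟩ i = M u i + p i * u i

/-- Subtracting the bounded multiplication by `v` from `M` leaves the hopping operator, which is
therefore defined everywhere. Hence only `p` determines the domain. -/
theorem isDiagPerturbation_hopping {φ : Lat d → ℝ} {p v : Lat d → ℂ} {M : ell2 d →L[ℂ] ell2 d}
    {C : ℝ} (hC : 0 ≤ C) (hv : ∀ i, ‖v i‖ ≤ C)
    (hM : ∀ i j, M (basisVec j) i = (φ (i - j) : ℂ) + if i = j then v i else 0) :
    IsDiagPerturbation (matOp (hopping φ) + matOp (Matrix.diagonal (p + v))) p M := by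
  obtain ⟨G, hG, -⟩ := exists_mulOp hC hv
  have hsum : ∀ (u : ell2 d) i, HasSum (fun j => hopping φ i j * u j) ((M - G) u i) := by
    intro u i
    convert hasSum_clm_apply (M - G) u i using 2 with j
    rw [sub_apply, lp.coeFn_sub, Pi.sub_apply, hM, hG, basisVec_apply]
    simp [hopping, mul_comm]
  have hact : ∀ u : ell2 d, matAct (hopping φ) u = (M - G) u := fun u =>
    funext fun i => (hsum u i).tsum_eq
  have hhop : ∀ u : ell2 d, u ∈ (matOp (hopping φ)).domain := fun u =>
    ⟨fun i => (hsum u i).summable, by rw [hact]; exact lp.memℓp _⟩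
  have hdact : ∀ u : ell2 d, matAct (Matrix.diagonal (p + v)) u = fun i => (p + v) i * u i :=
    fun u => funext fun i => (matAct_diagonal (p + v) u i).tsum_eq
  constructor
  · intro u
    have e : (fun i => (p + v) i * u i) = (fun i => p i * u i) + (G u : Lat d → ℂ) := by
      funext i
      rw [Pi.add_apply, Pi.add_apply, hG, add_mul]
    constructor
    · rintro ⟨-, h⟩
      have h2 : Memℓp (matAct (Matrix.diagonal (p + v)) u) 2 := h.2
      rw [hdact, e] at h2
      simpa using h2.sub (lp.memℓp (G u))
    · intro h
      refine ⟨hhop u, fun i => (matAct_diagonal (p + v) u i).summable, ?_⟩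
      rw [hdact, e]
      exact h.add (lp.memℓp (G u))
  · intro u h i
    rw [LinearPMap.add_apply]
    change matAct (hopping φ) u i + matAct (Matrix.diagonal (p + v)) u i = _
    rw [hact, hdact, sub_apply, lp.coeFn_sub, Pi.sub_apply, hG]
    change M u i - v i * u i + (p i + v i) * u i = _
    ring

namespace IsDiagPerturbation
variable {H : ell2 d →ₗ.[ℂ] ell2 d} {p : Lat d → ℂ} {M Q P : ell2 d →L[ℂ] ell2 d}

/-- The relation on basis vectors extends by expanding `w`. The vector `w'` plays the role of `D w`,
so its existence encodes that `w` lies in the domain of `D`. -/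
theorem conj_apply
    (hMQ : ∀ i j, M (Q (basisVec j)) i + p i * Q (basisVec j) i = p j * Q (basisVec j) i)
    {w w' : ell2 d} (hw : ∀ i, w' i = p i * w i) (i : Lat d) :
    M (Q w) i + p i * Q w i = Q w' i := by
  refine HasSum.unique ((hasSum_clm_apply (M * Q) w i).add
    ((hasSum_clm_apply Q w i).mul_left (p i))) ?_
  convert hasSum_clm_apply Q w' i using 2 with j
  rw [hw]
  change w j * M (Q (basisVec j)) i + p i * (w j * Q (basisVec j) i) = _
  linear_combination w j * hMQ i j

theorem conj_mem (h : IsDiagPerturbation H p M)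
    (hMQ : ∀ i j, M (Q (basisVec j)) i + p i * Q (basisVec j) i = p j * Q (basisVec j) i)
    {w w' : ell2 d} (hw : ∀ i, w' i = p i * w i) :
    ∃ hd : Q w ∈ H.domain, H ⟨Q w, hd⟩ = Q w' := by
  have hd : Q w ∈ H.domain := by
    rw [h.mem_domain_iff]
    have e : (fun i => p i * Q w i) = (Q w' : Lat d → ℂ) - (M (Q w) : Lat d → ℂ) := by
      funext i
      rw [Pi.sub_apply, ← conj_apply hMQ hw i, add_sub_cancel_left]
    rw [e]
    exact (lp.memℓp _).sub (lp.memℓp _)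
  exact ⟨hd, lp.ext (funext fun i => by rw [h.apply, conj_apply hMQ hw])⟩

theorem isEigenvector (h : IsDiagPerturbation H p M)
    (hMQ : ∀ i j, M (Q (basisVec j)) i + p i * Q (basisVec j) i = p j * Q (basisVec j) i)
    (hPQ : P * Q = 1) (j : Lat d) : IsEigenvector H (p j) (Q (basisVec j)) := by
  have hw : ∀ i, (p j • basisVec j : ell2 d) i = p i * basisVec j i := by
    intro i
    rw [lp.coeFn_smul, Pi.smul_apply, basisVec_apply]
    by_cases hij : i = j <;> simp [hij]
  obtain ⟨hd, he⟩ := h.conj_mem hMQ hw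
  refine ⟨fun h0 => ?_, hd, by rw [he, map_smul]⟩
  have h1 : P (Q (basisVec j)) = basisVec j := congrArg (fun L : ell2 d →L[ℂ] ell2 d =>
    L (basisVec j)) hPQ
  rw [h0, map_zero] at h1
  have h2 := congrArg (fun u : ell2 d => u j) h1
  simp [basisVec_apply] at h2

theorem span_dense (hQP : Q * P = 1) :
    (Submodule.span ℂ (Set.range fun j => Q (basisVec j))).topologicalClosure = ⊤ := by
  have hs : Function.Surjective Q := fun u => ⟨P u, congrArg (fun L : ell2 d →L[ℂ] ell2 d =>
    L u) hQP⟩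
  rw [← Submodule.dense_iff_topologicalClosure_eq_top]
  have h1 := (Submodule.dense_iff_topologicalClosure_eq_top.2 (span_basisVec_dense (d := d)))
  have h2 := hs.denseRange.dense_image Q.continuous h1
  convert h2
  have : (Set.range fun j => Q (basisVec j)) = Q '' Set.range basisVec := by
    rw [← Set.range_comp]; rfl
  rw [this]
  exact congrArg _ (Submodule.span_image (Q : ell2 d →ₗ[ℂ] ell2 d))

theorem isCompleteEigenfamily (h : IsDiagPerturbation H p M)
    (hMQ : ∀ i j, M (Q (basisVec j)) i + p i * Q (basisVec j) i = p j * Q (basisVec j) i)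
    (hPQ : P * Q = 1) (hQP : Q * P = 1) :
    IsCompleteEigenfamily H fun j => Q (basisVec j) :=
  ⟨fun j => ⟨p j, h.isEigenvector hMQ hPQ j⟩, span_dense hQP⟩

/-- Off the closure of the eigenvalues, `Q (D - z)⁻¹ Q⁻¹` is a right inverse of `H - z`. -/
theorem exists_rightInverse (h : IsDiagPerturbation H p M)
    (hMQ : ∀ i j, M (Q (basisVec j)) i + p i * Q (basisVec j) i = p j * Q (basisVec j) i)
    (hQP : Q * P = 1) {z : ℂ} {c : ℝ} (hc : 0 < c) (hz : ∀ i, c ≤ ‖p i - z‖) :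
    ∃ G : ell2 d →L[ℂ] ell2 d, (∀ u i, G u i = (p i - z)⁻¹ * u i) ∧ ‖G‖ ≤ c⁻¹ ∧
      ∀ v, ∃ hd : Q (G (P v)) ∈ H.domain, H ⟨Q (G (P v)), hd⟩ - z • Q (G (P v)) = v := by
  have hne : ∀ i, p i - z ≠ 0 := fun i => norm_pos_iff.1 (hc.trans_le (hz i))
  obtain ⟨G, hG, hGn⟩ := exists_mulOp (g := fun i => (p i - z)⁻¹) (inv_nonneg.2 hc.le) fun i => by
    rw [norm_inv]
    exact inv_anti₀ hc (hz i)
  refine ⟨G, hG, hGn, fun v => ?_⟩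
  -- Since `(D - z) G = 1`, the vector `D (G (P v))` is `P v + z • G (P v)`; `H` then sends `Q (G (P
  -- v))` to `Q` of it.
  have hw : ∀ i, (P v + z • G (P v) : ell2 d) i = p i * G (P v) i := by
    intro i
    rw [lp.coeFn_add, Pi.add_apply, lp.coeFn_smul, Pi.smul_apply, hG, smul_eq_mul]
    field_simp [hne i]
    ring
  obtain ⟨hd, he⟩ := h.conj_mem hMQ hw
  refine ⟨hd, ?_⟩
  rw [he, map_add, map_smul, add_sub_cancel_right]
  exact congrArg (fun L : ell2 d →L[ℂ] ell2 d => L v) hQP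

/-- This is surjectivity of `Q` from the domain of `D` onto that of `H`. The right inverse gives a
`u'` in the image with `(H - z) u' = (H - z) u`, and for `z` far from the real axis `H - z` is
injective, whence `u = u'`. -/
theorem exists_eq_conj (h : IsDiagPerturbation H p M)
    (hMQ : ∀ i j, M (Q (basisVec j)) i + p i * Q (basisVec j) i = p j * Q (basisVec j) i)
    (hQP : Q * P = 1) {r : Lat d → ℝ} (hr : ∀ i, p i = (r i : ℂ)) {u : ell2 d}
    (hu : u ∈ H.domain) :
    ∃ w w' : ell2 d, (∀ i, w' i = p i * w i) ∧ u = Q w := by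
  -- For real `p` the point `z = i (‖M‖ + 1)` has distance at least `‖M‖ + 1` from every `p i`. So
  -- `(D - z)⁻¹ M` has norm below `1`, and `(D - z) y = -M y` forces `y = 0`.
  set c := ‖M‖ + 1 with hc
  have hc0 : 0 < c := by positivity
  set z : ℂ := c * Complex.I with hz
  have hpz : ∀ i, c ≤ ‖p i - z‖ := by
    intro i
    have := Complex.abs_im_le_norm (p i - z)
    rw [hr, hz] at this
    simp only [Complex.sub_im, Complex.ofReal_im, Complex.mul_im, Complex.ofReal_re, Complex.I_im,
      Complex.I_re, mul_one, mul_zero, add_zero, zero_sub, abs_neg, abs_of_pos hc0] at this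
    rwa [hr]
  have hne : ∀ i, p i - z ≠ 0 := fun i => norm_pos_iff.1 (hc0.trans_le (hpz i))
  obtain ⟨G, hG, hGn, hR⟩ := h.exists_rightInverse hMQ hQP hc0 hpz
  set f : ell2 d := H ⟨u, hu⟩ - z • u with hf
  obtain ⟨hd, he⟩ := hR f
  refine ⟨G (P f), P f + z • G (P f), fun i => ?_, ?_⟩
  · rw [lp.coeFn_add, Pi.add_apply, lp.coeFn_smul, Pi.smul_apply, hG, smul_eq_mul]
    field_simp [hne i]
    ring
  · set u' := Q (G (P f)) with hu'
    have hy : u - u' = -G (M (u - u')) := by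
      apply lp.ext
      funext i
      have e := congrArg (fun x : ell2 d => x i) (he.trans hf)
      simp only [lp.coeFn_sub, lp.coeFn_smul, Pi.sub_apply, Pi.smul_apply, h.apply,
        smul_eq_mul] at e
      rw [lp.coeFn_neg, Pi.neg_apply, hG, map_sub, lp.coeFn_sub, lp.coeFn_sub, Pi.sub_apply,
        Pi.sub_apply, ← mul_right_inj' (hne i), mul_neg, mul_inv_cancel_left₀ (hne i)]
      linear_combination -e
    have hn : ‖u - u'‖ ≤ c⁻¹ * (‖M‖ * ‖u - u'‖) := by
      calc ‖u - u'‖ = ‖G (M (u - u'))‖ := by conv_lhs => rw [hy, norm_neg]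
        _ ≤ ‖G‖ * ‖M (u - u')‖ := G.le_opNorm _
        _ ≤ _ := by gcongr; exact M.le_opNorm _
    rw [inv_mul_eq_div, le_div_iff₀ hc0, hc] at hn
    have : ‖u - u'‖ ≤ 0 := by linarith
    exact sub_eq_zero.1 (norm_le_zero_iff.1 this)

/-- Off the closure of the eigenvalues the resolvent is `Q (D - z)⁻¹ P`. Conversely, a resolvent `R`
at a point `x` of the closure satisfies `(p j - x) R e_j = e_j` on each eigenvector, which is
impossible once `|p j - x| < (‖R‖ + 1)⁻¹`. -/
theorem opSpectrum_eq (h : IsDiagPerturbation H p M)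
    (hMQ : ∀ i j, M (Q (basisVec j)) i + p i * Q (basisVec j) i = p j * Q (basisVec j) i)
    (hPQ : P * Q = 1) (hQP : Q * P = 1) {r : Lat d → ℝ} (hr : ∀ i, p i = (r i : ℂ)) :
    opSpectrum H = (fun x : ℝ => (x : ℂ)) '' closure (Set.range r) := by
  have hPQ' : ∀ w, P (Q w) = w := fun w => congrArg (fun L : ell2 d →L[ℂ] ell2 d => L w) hPQ
  apply Set.Subset.antisymm
  · intro z hz
    by_contra hz'
    apply hz
    have hcl : IsClosed ((fun x : ℝ => (x : ℂ)) '' closure (Set.range r)) :=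
      Complex.isometry_ofReal.isClosedEmbedding.isClosedMap _ isClosed_closure
    obtain ⟨c, hc, hball⟩ := Metric.isOpen_iff.1 hcl.isOpen_compl z hz'
    have hpz : ∀ i, c ≤ ‖p i - z‖ := by
      intro i
      by_contra hlt
      refine hball (a := p i) ?_ ⟨r i, subset_closure ⟨i, rfl⟩, (hr i).symm⟩
      rw [Metric.mem_ball, dist_eq_norm]
      exact not_le.1 hlt
    have hne : ∀ i, p i - z ≠ 0 := fun i => norm_pos_iff.1 (hc.trans_le (hpz i))
    obtain ⟨G, hG, -, hR⟩ := h.exists_rightInverse hMQ hQP hc hpz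
    refine ⟨Q * G * P, hR, ?_⟩
    rintro ⟨u, hu⟩
    obtain ⟨w, w', hw, rfl⟩ := h.exists_eq_conj hMQ hQP hr hu
    obtain ⟨hd, he⟩ := h.conj_mem hMQ hw
    rw [he]
    change Q (G (P (Q w' - z • Q w))) = Q w
    rw [map_sub, map_smul, hPQ', hPQ']
    congr 1
    apply lp.ext
    funext i
    rw [hG, lp.coeFn_sub, Pi.sub_apply, lp.coeFn_smul, Pi.smul_apply, hw, smul_eq_mul, ← sub_mul,
      inv_mul_cancel_left₀ (hne i)]
  · rintro _ ⟨x, hx, rfl⟩ ⟨R, -, hR⟩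
    obtain ⟨_, ⟨j, rfl⟩, hj⟩ := Metric.mem_closure_iff.1 hx (‖R‖ + 1)⁻¹ (by positivity)
    obtain ⟨hne, hd, he⟩ := h.isEigenvector hMQ hPQ j
    have h1 := hR ⟨_, hd⟩
    rw [he] at h1
    simp only [← sub_smul, map_smul] at h1
    have h2 := congrArg norm h1
    rw [norm_smul, hr, ← Complex.ofReal_sub, Complex.norm_real, ← dist_eq_norm, dist_comm] at h2
    have h3 := R.le_opNorm (Q (basisVec j))
    have h4 := norm_pos_iff.2 hne
    rw [inv_eq_one_div, lt_div_iff₀ (by positivity)] at hj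
    have h5 : dist x (r j) * ‖R (Q (basisVec j))‖ ≤
        dist x (r j) * (‖R‖ * ‖Q (basisVec j)‖) := by gcongr
    nlinarith [dist_nonneg (x := x) (y := r j)]

end IsDiagPerturbation

/-! ### Auxiliary facts for the final assembly. -/

theorem exists_units_of_norm_sub_one_le {Q : ell2 d →L[ℂ] ell2 d} (hQ : ‖Q - 1‖ ≤ 1 / 2) :
    ∃ P : ell2 d →L[ℂ] ell2 d, P * Q = 1 ∧ Q * P = 1 := by
  have h : ‖1 - Q‖ < 1 := by
    rw [norm_sub_rev]
    linarith
  obtain ⟨U, hU⟩ : IsUnit Q := ⟨Units.oneSub (1 - Q) h, by simp⟩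
  rw [← hU]
  exact ⟨(U⁻¹ : (ell2 d →L[ℂ] ell2 d)ˣ), U.inv_mul, U.mul_inv⟩

theorem kDiag_diagonal (v : Lat d → ℂ) (k : Lat d) :
    kDiag (Matrix.diagonal v) k = if k = 0 then v else 0 := by
  funext i
  by_cases hk : k = 0
  · simp [hk, kDiag]
  · have : i ≠ i - k := fun h => hk (by simpa using h.symm)
    simp [hk, kDiag, this]

theorem TransInvBanachAlgebra.diagonal_mem_diagSpace (B : TransInvBanachAlgebra d) {v : Lat d → ℂ}
    (hv : v ∈ B.carrier) : Matrix.diagonal v ∈ B.diagSpace := by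
  have hz : ∀ i j, i ≠ j → Matrix.diagonal v i j = 0 := fun i j h => Matrix.diagonal_apply_ne _ h
  refine ⟨fun s _ => ⟨fun k => ?_, ?_⟩, hz⟩
  · rw [kDiag_diagonal]
    split_ifs
    exacts [hv, B.carrier.zero_mem]
  · rw [B.sobNorm_of_diagonal hz, kDiag_diagonal, if_pos rfl, B.extNorm_of_mem hv]
    exact ENNReal.ofReal_lt_top

theorem IsCompleteEigenfamily.hasPurePointSpectrum {H : ell2 d →ₗ.[ℂ] ell2 d} {e : Lat d → ell2 d}
    (h : IsCompleteEigenfamily H e) : HasPurePointSpectrum H := by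
  rw [HasPurePointSpectrum, eq_top_iff, ← h.2]
  refine Submodule.topologicalClosure_mono (Submodule.span_mono ?_)
  rintro _ ⟨k, rfl⟩
  exact h.1 k

/-- A threshold below which finitely many linear and sublinear smallness conditions hold. -/
theorem exists_threshold (a b c c₂ x : ℝ) (ha : 0 ≤ a) (hb : 0 ≤ b) (hc : 0 ≤ c) (hc₂ : 0 ≤ c₂) :
    ∃ ε₀ : ℝ, 0 < ε₀ ∧ ∀ ε, 0 ≤ ε → ε ≤ ε₀ → a * ε ≤ 1 ∧ b * ε ≤ 1 ∧ c * ε ≤ 1 ∧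
      c₂ * ε ^ 2 ≤ ε ∧ (1 / 2 < x → c₂ * ε ^ 2 ≤ ε ^ (1 / x)) := by
  set m := 1 + a + b + c + c₂ with hm
  have hm1 : 1 ≤ m := by linarith
  have hm0 : 0 < m := by linarith
  -- For `x > 1/2` the exponent `y` is positive, so `ε ^ 2 = ε ^ y * ε ^ (1 / x)` with `ε ^ y` small
  -- enough to absorb `c₂`. The second entry of the minimum below ensures this.
  set y := 2 - 1 / x with hy
  refine ⟨min m⁻¹ (m⁻¹ ^ y⁻¹), lt_min (by positivity) (by positivity), fun ε hε hle => ?_⟩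
  have h1 : m * ε ≤ 1 := by
    have := mul_le_mul_of_nonneg_left (hle.trans (min_le_left _ _)) hm0.le
    rwa [mul_inv_cancel₀ hm0.ne'] at this
  have key : ∀ u, 0 ≤ u → u ≤ m → u * ε ≤ 1 := fun u _ hu =>
    (mul_le_mul_of_nonneg_right hu hε).trans h1
  refine ⟨key a ha (by linarith), key b hb (by linarith), key c hc (by linarith), ?_, fun hx => ?_⟩
  · have := mul_le_mul_of_nonneg_right (key c₂ hc₂ (by linarith)) hε
    linarith
  · have hx0 : 0 < x := by linarith
    have hy0 : 0 < y := by
      rw [hy, sub_pos, div_lt_iff₀ hx0]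
      linarith
    rcases hε.eq_or_lt with rfl | hε0
    · simpa using Real.rpow_nonneg le_rfl _
    · have h2 : ε ^ y ≤ m⁻¹ := by
        have := Real.rpow_le_rpow hε (hle.trans (min_le_right _ _)) hy0.le
        rwa [← Real.rpow_mul (by positivity), inv_mul_cancel₀ hy0.ne', Real.rpow_one] at this
      have h3 : c₂ * ε ^ y ≤ 1 := by
        calc c₂ * ε ^ y ≤ m * m⁻¹ := by gcongr; linarith
          _ = 1 := mul_inv_cancel₀ hm0.ne'
      calc c₂ * ε ^ 2 = c₂ * ε ^ y * ε ^ (1 / x) := by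
            rw [mul_assoc, ← Real.rpow_add hε0, hy, sub_add_cancel]
            norm_num
        _ ≤ 1 * ε ^ (1 / x) := by gcongr
        _ = _ := one_mul _

end PowerLaw

open PowerLaw
-- Choice of the parameters and conclusion.
theorem corollary2p3 (d : ℕ) (α₀ τ δ s : ℝ) (hα₀ : (d : ℝ) / 2 < α₀) (hτ : 0 < τ) (hδ : 0 < δ)
    (hs : α₀ + τ + (d : ℝ) / 2 + 12 * δ < s) :
    ∃ C : ℝ, 0 < C ∧ ∀ γ : ℝ, 0 < γ → ∃ ε₀ : ℝ, 0 < ε₀ ∧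
      ∀ (B : TransInvBanachAlgebra d) (φ : Lat d → ℝ) (p : Lat d → ℂ),
        φ 0 = 0 → (∀ i : Lat d, i ≠ 0 → |φ i| ≤ ‖i‖ ^ (-s)) →
        p ∈ B.distal τ γ →
        B.sobNorm (hopping φ) (s - (d : ℝ) / 2 - δ) ≤ ENNReal.ofReal ε₀ →
        ∃ p' : Lat d → ℂ,
          Matrix.diagonal p' - Matrix.diagonal p ∈ B.diagSpace ∧
          B.sobNorm (Matrix.diagonal p - Matrix.diagonal p') 0 ≤
            ENNReal.ofReal C * B.sobNorm (hopping φ) (s - (d : ℝ) / 2 - δ) ∧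
          (1 / 2 < s - (d : ℝ) / 2 - 5 * δ - α₀ →
            B.sobNorm (Matrix.diagonal p - Matrix.diagonal p') 0 ≤
              ENNReal.ofReal C * B.sobNorm (hopping φ) (s - (d : ℝ) / 2 - δ) ^
                (1 / (s - (d : ℝ) / 2 - 5 * δ - α₀))) ∧
          HasPurePointSpectrum (matOp (hopping φ) + matOp (Matrix.diagonal p')) ∧
          (∃ e : Lat d → ell2 d,
            IsCompleteEigenfamily (matOp (hopping φ) + matOp (Matrix.diagonal p')) e ∧
            ∀ i k : Lat d,
              ‖e k i‖ ≤ 2 * bracket (i - k) ^ (-s + τ + (d : ℝ) / 2 + 12 * δ)) ∧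
          ∀ r : Lat d → ℝ, (∀ i, p i = (r i : ℂ)) →
            opSpectrum (matOp (hopping φ) + matOp (Matrix.diagonal p')) =
              (fun x : ℝ => (x : ℂ)) '' closure (Set.range r) := by
  -- `C = 1` suffices: the counterterm is at most `c₂ ε ^ 2`, and the threshold absorbs `c₂`.
  refine ⟨1, one_pos, fun γ hγ => ?_⟩
  -- The given regularity `s - d/2 - δ` is split as `t + τ + σ`: `t` is the final decay rate, `τ`
  -- pays for the divisors and `σ = 11 δ` makes the corrections summable. The hypothesis on `s` says
  -- `t > α₀`, hence `t > d/2`.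
  set t := s - (d : ℝ) / 2 - 12 * δ - τ with ht
  set σ := 11 * δ with hσ
  have hσ0 : 0 < σ := by positivity
  have htd : (d : ℝ) / 2 < t := by linarith
  have hr : t + τ + σ = s - (d : ℝ) / 2 - δ := by rw [ht, hσ]; ring
  set x := s - (d : ℝ) / 2 - 5 * δ - α₀ with hx
  set ρ : ℝ := (3 : ℝ) ^ (-(τ + σ)) with hρ
  set q : ℝ := (3 : ℝ) ^ (-σ) with hq
  set K := (algConst d t).toReal with hK
  have hρ0 : 0 < ρ := Real.rpow_pos_of_pos (by norm_num) _
  have hρ1 : ρ < 1 := Real.rpow_lt_one_of_one_lt_of_neg (by norm_num) (by linarith)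
  have hq1 : 0 < 1 - q :=
    sub_pos.2 (Real.rpow_lt_one_of_one_lt_of_neg (by norm_num) (by linarith))
  have hρ2 : 0 < 1 - ρ := sub_pos.2 hρ1
  have hK0 : 0 ≤ K := ENNReal.toReal_nonneg
  have hE0 : 0 ≤ embConst d t := ENNReal.toReal_nonneg
  -- `c₁ ε` will be the bound `c` for `Q - 1`, and `c₂ ε ^ 2` the bound for the counterterm.
  set c₁ := 2 * (γ⁻¹ * 2 ^ τ * (4 / ρ)) / (1 - q) with hc₁
  have hc₁0 : 0 ≤ c₁ := by positivity
  set c₂ := 4 * K * c₁ * (4 / ρ) / ρ / (1 - ρ) with hc₂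
  -- The three linear conditions are `K c ≤ ρ / 16` for the iteration, `embConst * c ≤ 1/2` for the
  -- invertibility of `Q`, and `c ≤ 1` for the factor `2` in the decay of the eigenfunctions.
  obtain ⟨ε₀, hε₀, hsmall⟩ := exists_threshold (16 * K * c₁ / ρ) (2 * embConst d t * c₁) c₁ c₂ x
    (by positivity) (by positivity) hc₁0 (by positivity)
  refine ⟨ε₀, hε₀, fun B φ p hφ _ hp hT => ?_⟩
  set N := B.sobNorm (hopping φ) (s - (d : ℝ) / 2 - δ) with hN
  set ε := N.toReal with hε
  have hε0 : 0 ≤ ε := ENNReal.toReal_nonneg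
  have hNε : N = ENNReal.ofReal ε :=
    (ENNReal.ofReal_toReal (hT.trans_lt ENNReal.ofReal_lt_top).ne).symm
  have hle : ε ≤ ε₀ := by
    rwa [hNε, ENNReal.ofReal_le_ofReal_iff hε₀.le] at hT
  obtain ⟨s1, s2, s3, s4, s5⟩ := hsmall ε hε0 hle
  have hc : 2 * (γ⁻¹ * 2 ^ τ * (4 * ε / ρ)) / (1 - q) = c₁ * ε := by rw [hc₁]; ring
  let S : NewtonData d :=
    { B := B, p := p, φ := φ, t := t, τ := τ, σ := σ, γ := γ, ε := ε, ht := htd, hτ := hτ,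
      hσ := hσ0, hγ := hγ, hε := hε0, hφ := hφ, hp := hp
      hT := by rw [hr, ← hN, hNε]
      small := by
        rw [← hρ, ← hq, ← hK, hc]
        have e : 16 * K * c₁ / ρ * ε = K * (c₁ * ε) / (ρ / 16) := by field_simp
        rwa [e, div_le_one (by positivity)] at s1 }
  have hSc : S.c = c₁ * ε := hc
  obtain ⟨v, M, Q, hv, hM, hMQ, hQ, hQe⟩ := S.exists_conjugation (by
    rw [hSc]
    change embConst d t * (c₁ * ε) ≤ _
    linarith)
  have hv' : B.extNorm v ≤ ENNReal.ofReal (c₂ * ε ^ 2) := by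
    refine hv.trans (le_of_eq (congrArg _ ?_))
    rw [hSc, hc₂]
    change 4 * K * (c₁ * ε) * (4 * ε / ρ) / ρ / (1 - ρ) = _
    ring
  have hmem : v ∈ B.carrier :=
    B.mem_of_extNorm_ne_top (hv'.trans_lt ENNReal.ofReal_lt_top).ne
  have hvi : ∀ i, ‖v i‖ ≤ c₂ * ε ^ 2 := fun i =>
    (ENNReal.ofReal_le_ofReal_iff (by positivity)).1 ((B.norm_apply_le_extNorm v i).trans hv')
  have hdiag : B.sobNorm (Matrix.diagonal p - Matrix.diagonal (p + v)) 0 = B.extNorm v := by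
    have e : Matrix.diagonal p - Matrix.diagonal (p + v) = Matrix.diagonal (-v) := by
      rw [Matrix.diagonal_sub]
      congr 1
      funext i
      simp
    rw [e, B.sobNorm_of_diagonal fun i j h => Matrix.diagonal_apply_ne _ h, kDiag_diagonal,
      if_pos rfl, B.extNorm_neg]
  obtain ⟨P, hPQ, hQP⟩ := exists_units_of_norm_sub_one_le hQ
  have hH := isDiagPerturbation_hopping (p := p) (by positivity) hvi hM
  have hfam := hH.isCompleteEigenfamily hMQ hPQ hQP
  refine ⟨p + v, ?_, ?_, fun hx2 => ?_, hfam.hasPurePointSpectrum, ⟨_, hfam, fun i k => ?_⟩,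
    fun r hr => hH.opSpectrum_eq hMQ hPQ hQP hr⟩
  · have e : Matrix.diagonal (p + v) - Matrix.diagonal p = Matrix.diagonal v := by
      rw [Matrix.diagonal_sub]
      congr 1
      funext i
      simp
    rw [e]
    exact B.diagonal_mem_diagSpace hmem
  · rw [hdiag, ENNReal.ofReal_one, one_mul, hNε]
    exact hv'.trans (ENNReal.ofReal_le_ofReal s4)
  · rw [hdiag, ENNReal.ofReal_one, one_mul, hNε,
      ENNReal.ofReal_rpow_of_nonneg hε0 (one_div_nonneg.2 (by linarith))]
    exact hv'.trans (ENNReal.ofReal_le_ofReal (s5 hx2))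
  · have he : -s + τ + (d : ℝ) / 2 + 12 * δ = -t := by rw [ht]; ring
    rw [he]
    have h1 := hQe i k
    rw [hSc] at h1
    have hb : 0 ≤ bracket (i - k) ^ (-t) := Real.rpow_nonneg (bracket_pos _).le _
    have h2 : ‖(if i = k then 1 else 0 : ℂ)‖ ≤ bracket (i - k) ^ (-t) := by
      split_ifs with h
      · simp [h, bracket_zero]
      · simpa using hb
    have h3 := norm_le_norm_add_norm_sub' (Q (basisVec k) i) (if i = k then 1 else 0 : ℂ)
    have h4 := mul_le_mul_of_nonneg_right s3 hb
    have h5 : c₁ * ε * bracket (i - k) ^ (-S.t) = c₁ * ε * bracket (i - k) ^ (-t) := rfl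
    linarith
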